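/- Let $X_1,X_2,\dots$ be independent real random variables with a common continuous distribution function, and let $\mathcal F_i=\sigma(X_1,\dots,X_i)$. For $d\ge 0$ call a finite sequence $d$-modal if it is the concatenation of at most $d+1$ monotone (in the weak sense) blocks that are alternately increasing and decreasing, the first block being an increasing one; blocks may be empty or of size one. Let $\Pi_d(n)$ be the set of feasible policies for the sequential selection of a $d$-modal subsequence of $X_1,\dots,X_n$: for each $1\le i\le n$, the decision to accept or to reject $X_i$ is $\mathcal F_i$-measurable, and the selected subsequence is always $d$-modal. Let $U^{o,d}_n(\pi_n)$ be the number of observations selected by $\pi_n\in\Pi_d(n)$, and put $c(d)=2(d+1)$. Theorem (Expected Length of Optimal $d$-Modal Subsequences). For all $n\ge 1$ and $d\ge 0$ there is a policy $\pi^*_n\in\Pi_d(n)$, unique up to a null event (any two such policies almost surely select the same observations), such that $$\mathbb E[U^{o,d}_n(\pi^*_n)]=\sup_{\pi_n\in\Pi_d(n)}\mathbb E[U^{o,d}_n(\pi_n)].$$ Moreover, there is an absolute constant $C$ (independent of $n$, of $d$ and of the distribution of the $X_i$) such that for all $n\ge 1$ and $d\ge 0$ $$c(d)^{1/2}n^{1/2}-c(d)^{3/4}(\pi/3)^{1/2}n^{1/4}-C<\mathbb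 E[U^{o,d}_n(\pi^*_n)]<c(d)^{1/2}n^{1/2}.$$ In particular, for each fixed $d\ge 0$, $\mathbb E[U^{o,d}_n(\pi^*_n)]\sim\{2(d+1)\}^{1/2}n^{1/2}$ as $n\to\infty$. The case $d=0$ is the selection of an increasing subsequence. -/

import Mathlib

open MeasureTheory ProbabilityTheory Filter

namespace ModalSelection

/-- The finite subsequence `(x i)`, `i ∈ s`, is `d`-modal: it is the concatenation of at most `d + 1`
monotone blocks, numbered `0, 1, …, d` from left to right, which are alternately weakly increasing
(even number) and weakly decreasing (odd number). The first block is an increasing one; blocks may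
be empty or have size one. -/
def IsModal {n : ℕ} (d : ℕ) (x : Fin n → ℝ) (s : Finset (Fin n)) : Prop :=
  ∃ block : Fin n → ℕ, MonotoneOn block s ∧ (∀ i ∈ s, block i ≤ d) ∧
    ∀ i ∈ s, ∀ j ∈ s, i < j → block i = block j →
      (Even (block i) → x i ≤ x j) ∧ (Odd (block i) → x j ≤ x i)

/-- The σ-field generated by the observations `X 0, …, X i`. -/
abbrev history {Ω : Type*} (X : ℕ → Ω → ℝ) (i : ℕ) : MeasurableSpace Ω :=
  ⨆ j ≤ i, MeasurableSpace.comap (X j) inferInstance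

/-- A feasible policy for the sequential selection of a `d`-modal subsequence of the first `n`
observations `X 0, …, X (n - 1)`: whether the `i`-th observation is selected is decided on the
basis of the observations up to and including the `i`-th one, and the selected subsequence is
always `d`-modal. -/
structure Policy {Ω : Type*} (X : ℕ → Ω → ℝ) (d n : ℕ) where
  /-- The set of indices of the selected observations. -/
  selected : Ω → Finset (Fin n)
  nonanticipating : ∀ i : Fin n, MeasurableSet[history X i] {ω | i ∈ selected ω}
  modal : ∀ ω, IsModal d (fun i : Fin n => X i ω) (selected ω)

/-- The expected length of the subsequence selected by a policy. -/
noncomputable def expectedLength {Ω : Type*} [MeasurableSpace Ω] (μ : Measure Ω)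
    {X : ℕ → Ω → ℝ} {d n : ℕ} (p : Policy X d n) : ℝ :=
  ∫ ω, ((p.selected ω).card : ℝ) ∂μ

/-- A policy is optimal if its expected length is the supremum of the expected lengths of all
feasible policies. -/
def IsOptimal {Ω : Type*} [MeasurableSpace Ω] (μ : Measure Ω)
    {X : ℕ → Ω → ℝ} {d n : ℕ} (p : Policy X d n) : Prop :=
  IsLUB (Set.range fun q : Policy X d n => expectedLength μ q) (expectedLength μ p)

end ModalSelection

/-!
Replacing each observation by its score, the value of the distribution function at it, makes the
scores independent and uniform on `[0, 1]` (`map_cdf_eq_unif`). Lay the `d + 1` blocks out as one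
path `[0, d + 1]` along which the score goes up and down in turn (`pathPos`). Then a selection of
scores is `d`-modal if and only if they can be visited in order by moving forward on the path, and
it is best always to move on to the first position `nextPos y u` that has the score `u` of the
selected observation (`position_le_of_isModal`, `isModal_optSelected`). So the problem becomes a
Markov decision problem for a single real position `y`, with the value function `value d k y` for
`k` observations to come.

*Existence and uniqueness.* The expected length of any policy is `value d n 0` minus the sum of
its expected regrets (`expectedLength_eq`), which are nonnegative. The value is strictly
decreasing in the position as long as it is less than `k` (`value_lt_value`,
`value_eq_of_ceil_add_le`), so accepting and rejecting are almost surely not equally good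
(`ae_unif_no_tie`). Hence a policy is optimal exactly if it almost surely follows the rule
`Accepts` (`expectedLength_eq_value_iff`).

*Upper bound.* The distance to the next position has a density that is at most one. Therefore,
with `D = d + 1`, the function `c * (D - y) + k / (2 * c)` is a supersolution of the dynamic
programming equation for every `c > 0` (`value_lt_linear`), and `c = √(n / (2 * D))` gives
`√(2 * D * n)`.

*Lower bound.* Reserve `m = ⌊n / D⌋` observations for each block. Within a single block of
remaining length `r`, the function `√2 * (√(m * r) - (m * r) ^ (1 / 4))` is a subsolution
(`profilePos_add_le_integral`), because the window of length `√(2 * r / m)` loses only a term of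
order `1 / m` per step, which the fourth root makes up for. So `value d n 0` is at least
`D * √2 * (√m - m ^ (1 / 4))` (`mul_profilePos_le_value`), and the room between the coefficient of
this fourth root and `2 ^ (1 / 4) * √(π / 3)` absorbs the rounding of `n / D` (`rounding_le`).
-/

namespace ModalSelection

/-! ### The path of blocks -/

/-- The position in the block `b` of a score `u ∈ [0, 1]`. The `d + 1` blocks are laid out one
after another as the unit intervals `[b, b + 1]` of a path, along which the score goes up in the
even blocks and down in the odd ones; every selection then moves forward on the path. -/
noncomputable def pathPos (b : ℕ) (u : ℝ) : ℝ := b + if Even b then u else 1 - u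

/-- The block that contains `nextPos y u`: the block of `y` if the score `u` is still ahead of `y`
in it, and the following block otherwise. -/
noncomputable def nextBlock (y u : ℝ) : ℕ := if y ≤ pathPos ⌊y⌋₊ u then ⌊y⌋₊ else ⌊y⌋₊ + 1

/-- The first position at or after `y` that has the score `u`. -/
noncomputable def nextPos (y u : ℝ) : ℝ := pathPos (nextBlock y u) u

lemma pathPos_succ (b : ℕ) (u : ℝ) : pathPos (b + 1) u = 2 * (b + 1) - pathPos b u := by
  unfold pathPos
  rcases Nat.even_or_odd b with h | h
  · have h' : ¬ Even (b + 1) := by simp [Nat.even_add_one, h]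
    simp only [h, h', if_true, if_false]; push_cast; ring
  · have h' : Even (b + 1) := h.add_one
    have h'' : ¬ Even b := by simpa using h
    simp only [h', h'', if_true, if_false]; push_cast; ring

lemma le_pathPos {b : ℕ} {u : ℝ} (hu : u ∈ Set.Icc (0 : ℝ) 1) : (b : ℝ) ≤ pathPos b u := by
  unfold pathPos; split_ifs <;> linarith [hu.1, hu.2]

lemma pathPos_le {b : ℕ} {u : ℝ} (hu : u ∈ Set.Icc (0 : ℝ) 1) : pathPos b u ≤ b + 1 := by
  unfold pathPos; split_ifs <;> linarith [hu.1, hu.2]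

lemma nextPos_eq (y u : ℝ) : nextPos y u =
    if y ≤ pathPos ⌊y⌋₊ u then pathPos ⌊y⌋₊ u else 2 * (⌊y⌋₊ + 1) - pathPos ⌊y⌋₊ u := by
  unfold nextPos nextBlock
  split_ifs
  · rfl
  · exact pathPos_succ _ _

lemma le_nextPos {y u : ℝ} (hu : u ∈ Set.Icc (0 : ℝ) 1) : y ≤ nextPos y u := by
  rw [nextPos_eq]
  split_ifs with h
  · exact h
  · have := pathPos_le (b := ⌊y⌋₊) hu
    linarith [Nat.lt_floor_add_one y]

/-- `nextPos y u` is the least position with score `u` that is not before `y`. -/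
lemma nextPos_le {y u : ℝ} (hy : 0 ≤ y) (hu : u ∈ Set.Icc (0 : ℝ) 1) {b : ℕ}
    (h : y ≤ pathPos b u) : nextPos y u ≤ pathPos b u := by
  set a := ⌊y⌋₊ with ha
  have hay : (a : ℝ) ≤ y := Nat.floor_le hy
  have hb := pathPos_le (b := b) hu
  have hb' := le_pathPos (b := b) hu
  have ha1 := pathPos_le (b := a) hu
  have ha2 := le_pathPos (b := a) hu
  rw [nextPos_eq, ← ha]
  rcases lt_trichotomy b a with hlt | rfl | hlt
  · have h1 : (b : ℝ) + 1 ≤ a := by exact_mod_cast hlt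
    have h2 : a = b + 1 := by
      have : (a : ℝ) ≤ b + 1 := by linarith
      have : a ≤ b + 1 := by exact_mod_cast this
      omega
    have h3 := pathPos_succ b u
    rw [← h2] at h3
    split_ifs <;> linarith
  · rw [if_pos h]
  · rcases Nat.lt_or_ge (a + 1) b with h2 | h2
    · have h1 : (a : ℝ) + 2 ≤ b := by exact_mod_cast h2
      split_ifs <;> linarith
    · have : b = a + 1 := by omega
      subst this
      rw [pathPos_succ] at *
      push_cast at *
      split_ifs <;> linarith

lemma nextPos_mono {y y' u : ℝ} (hy : 0 ≤ y) (h : y ≤ y') (hu : u ∈ Set.Icc (0 : ℝ) 1) :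
    nextPos y u ≤ nextPos y' u :=
  nextPos_le hy hu (h.trans (le_nextPos hu))

lemma nextPos_le_ceil {y u : ℝ} (hy : 0 ≤ y) (hu : u ∈ Set.Icc (0 : ℝ) 1) :
    nextPos y u ≤ ⌈y⌉₊ + 1 :=
  (nextPos_le hy hu ((Nat.le_ceil y).trans (le_pathPos hu))).trans (pathPos_le hu)

lemma measurable_nextPos : Measurable (fun z : ℝ × ℝ => nextPos z.1 z.2) := by
  have h1 : Measurable (fun z : ℝ × ℝ => (⌊z.1⌋₊ : ℝ)) :=
    (measurable_from_nat (f := fun n : ℕ => (n : ℝ))).comp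
      (Nat.measurable_floor.comp measurable_fst)
  have h2 : Measurable (fun z : ℝ × ℝ => pathPos ⌊z.1⌋₊ z.2) := by
    unfold pathPos
    refine h1.add (Measurable.ite ?_ measurable_snd (by fun_prop))
    exact (Nat.measurable_floor.comp measurable_fst)
      (MeasurableSet.of_discrete (s := {n : ℕ | Even n}))
  simp_rw [nextPos_eq]
  exact Measurable.ite (measurableSet_le measurable_fst h2) h2 (by fun_prop)

/-- A position is reached from `y` by finitely many scores only. The four candidates in the proof
cover the two blocks in which `nextPos y u` can lie and the two directions of a block. -/
lemma finite_nextPos_eq (y z : ℝ) : {u : ℝ | nextPos y u = z}.Finite := by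
  refine Set.Finite.subset (s := {z - ⌊y⌋₊, 1 - (z - ⌊y⌋₊), 2 * (⌊y⌋₊ + 1) - z - ⌊y⌋₊,
    1 - (2 * (⌊y⌋₊ + 1) - z - ⌊y⌋₊)}) (by simp) ?_
  intro u hu
  simp only [Set.mem_ofPred_eq, nextPos_eq, pathPos] at hu
  simp only [Set.mem_insert_iff, Set.mem_singleton_iff]
  split_ifs at hu
  · left; linarith
  · right; right; left; linarith
  · right; left; linarith
  · right; right; right; linarith

/-- The uniform distribution on the unit interval. -/
noncomputable def unif : Measure ℝ := volume.restrict (Set.Icc 0 1)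

instance : IsProbabilityMeasure unif := ⟨by simp [unif]⟩

lemma ae_unif_mem : ∀ᵐ u ∂unif, u ∈ Set.Icc (0 : ℝ) 1 := ae_restrict_mem measurableSet_Icc

lemma integral_unif (f : ℝ → ℝ) : ∫ u, f u ∂unif = ∫ u in (0 : ℝ)..1, f u := by
  rw [unif, intervalIntegral.integral_of_le zero_le_one, integral_Icc_eq_integral_Ioc]

lemma ae_unif_nextPos_ne (y z : ℝ) : ∀ᵐ u ∂unif, nextPos y u ≠ z := by
  refine ae_restrict_of_ae ?_
  have := (finite_nextPos_eq y z).measure_zero volume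
  rw [ae_iff]; simpa using this

lemma integral_pathPos (b : ℕ) (g : ℝ → ℝ) :
    ∫ u in (0 : ℝ)..1, g (pathPos b u) = ∫ v in (0 : ℝ)..1, g (b + v) := by
  unfold pathPos
  split_ifs
  · rfl
  · have := intervalIntegral.integral_comp_sub_left (a := 0) (b := 1) (fun v => g (b + v)) 1
    simpa using this

/-- The law of the next position: it has density one on the rest of the current block and, after a
gap of the same length as that rest, on the part of the next block that lies across the turn from
the part of the current block already used. -/
lemma integral_nextPos {y : ℝ} (hy : 0 ≤ y) {ψ : ℝ → ℝ}
    (hψ : ∀ a c, IntervalIntegrable ψ volume a c) :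
    ∫ u, ψ (nextPos y u) ∂unif = (∫ z in y..(⌊y⌋₊ + 1), ψ z) +
      ∫ z in (2 * (⌊y⌋₊ + 1) - y)..(⌊y⌋₊ + 2), ψ z := by
  set b := ⌊y⌋₊ with hb
  have h1 : (b : ℝ) ≤ y := Nat.floor_le hy
  have h2 : y < b + 1 := Nat.lt_floor_add_one y
  rw [integral_unif]
  have e1 : ∫ u in (0 : ℝ)..1, ψ (nextPos y u) =
      ∫ v in (0 : ℝ)..1, ψ (if y ≤ b + v then b + v else 2 * (b + 1) - (b + v)) := by
    rw [← integral_pathPos b (fun x => ψ (if y ≤ x then x else 2 * (b + 1) - x))]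
    simp_rw [nextPos_eq, ← hb]
  rw [e1]
  have c1 : ∀ v ∈ Set.Ioo (0 : ℝ) (y - b),
      ψ (if y ≤ b + v then b + v else 2 * (b + 1) - (b + v)) = ψ ((b + 2) - v) := by
    intro v hv
    rw [if_neg (by linarith [hv.2])]; congr 1; ring
  have c2 : ∀ v ∈ Set.Ioo (y - b) 1,
      ψ (if y ≤ b + v then b + v else 2 * (b + 1) - (b + v)) = ψ (b + v) := by
    intro v hv
    rw [if_pos (by linarith [hv.1])]
  have i1 : IntervalIntegrable (fun v => ψ ((b + 2) - v)) volume 0 (y - b) := by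
    have := (hψ (b + 2) (b + 2 - (y - b))).comp_sub_left (b + 2)
    simpa using this
  have i2 : IntervalIntegrable (fun v => ψ (b + v)) volume (y - b) 1 := by
    have := (hψ y (b + 1)).comp_add_left b
    simpa using this
  have m1 : ∀ᵐ v ∂volume, v ≠ y - (b : ℝ) := by simp [ae_iff]
  have m2 : ∀ᵐ v ∂volume, v ≠ (1 : ℝ) := by simp [ae_iff]
  have j1 : ∀ᵐ v ∂volume, v ∈ Set.uIoc 0 (y - b) → ψ ((b + 2) - v) =
      ψ (if y ≤ b + v then b + v else 2 * (b + 1) - (b + v)) := by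
    filter_upwards [m1] with v hv hv'
    rw [Set.uIoc_of_le (by linarith)] at hv'
    exact (c1 v ⟨hv'.1, lt_of_le_of_ne hv'.2 hv⟩).symm
  have j2 : ∀ᵐ v ∂volume, v ∈ Set.uIoc (y - b) 1 → ψ (b + v) =
      ψ (if y ≤ b + v then b + v else 2 * (b + 1) - (b + v)) := by
    filter_upwards [m2] with v hv hv'
    rw [Set.uIoc_of_le (by linarith)] at hv'
    exact (c2 v ⟨hv'.1, lt_of_le_of_ne hv'.2 hv⟩).symm
  rw [← intervalIntegral.integral_add_adjacent_intervals (b := y - b)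
    (i1.congr_ae ((ae_restrict_iff' measurableSet_uIoc).2 j1))
    (i2.congr_ae ((ae_restrict_iff' measurableSet_uIoc).2 j2)),
    ← intervalIntegral.integral_congr_ae j1, ← intervalIntegral.integral_congr_ae j2,
    intervalIntegral.integral_comp_sub_left, intervalIntegral.integral_comp_add_left, add_comm]
  congr 2 <;> ring

/-! ### The value function -/

section Value

variable {d : ℕ}

/-- What the better of the two decisions about an observation with score `u` is worth at the
position `y`, when `f` is the value of a position afterwards. Accepting is possible only if the next
position does not exceed the end `d + 1` of the path. -/
noncomputable def bellman (d : ℕ) (f : ℝ → ℝ) (y u : ℝ) : ℝ :=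
  if nextPos y u ≤ d + 1 then max (f y) (1 + f (nextPos y u)) else f y

/-- The largest expected number of selections among the next `k` observations from the position `y`,
as given by dynamic programming. -/
noncomputable def value (d : ℕ) : ℕ → ℝ → ℝ
  | 0 => fun _ => 0
  | k + 1 => fun y => ∫ u, bellman d (value d k) y u ∂unif

lemma le_bellman (f : ℝ → ℝ) (y u : ℝ) : f y ≤ bellman d f y u := by
  unfold bellman; split_ifs
  · exact le_max_left _ _
  · exact le_rfl

lemma one_add_le_bellman (f : ℝ → ℝ) {y u : ℝ} (h : nextPos y u ≤ d + 1) :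
    1 + f (nextPos y u) ≤ bellman d f y u := by
  rw [bellman, if_pos h]; exact le_max_right _ _

lemma bellman_le {f : ℝ → ℝ} {y u c : ℝ} (h1 : f y ≤ c)
    (h2 : nextPos y u ≤ d + 1 → 1 + f (nextPos y u) ≤ c) : bellman d f y u ≤ c := by
  unfold bellman; split_ifs with h
  · exact max_le h1 (h2 h)
  · exact h1

lemma bellman_lt {f : ℝ → ℝ} {y u c : ℝ} (h1 : f y < c)
    (h2 : nextPos y u ≤ d + 1 → 1 + f (nextPos y u) < c) : bellman d f y u < c := by
  unfold bellman; split_ifs with h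
  · exact max_lt h1 (h2 h)
  · exact h1

lemma measurable_bellman {f : ℝ → ℝ} (hf : Measurable f) :
    Measurable (fun z : ℝ × ℝ => bellman d f z.1 z.2) := by
  unfold bellman
  refine Measurable.ite (measurableSet_le measurable_nextPos measurable_const) ?_
    (hf.comp measurable_fst)
  exact (hf.comp measurable_fst).max ((hf.comp measurable_nextPos).const_add 1)

lemma measurable_value (k : ℕ) : Measurable (value d k) := by
  induction k with
  | zero => exact measurable_const
  | succ k ih =>
    exact (measurable_bellman ih).stronglyMeasurable.integral_prod_right'.measurable

lemma bellman_mem {f : ℝ → ℝ} {k : ℕ} (hf : ∀ y, f y ∈ Set.Icc (0 : ℝ) k) (y u : ℝ) :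
    bellman d f y u ∈ Set.Icc (0 : ℝ) (k + 1) :=
  ⟨(hf y).1.trans (le_bellman f y u),
    bellman_le (by linarith [(hf y).2]) (fun _ => by linarith [(hf (nextPos y u)).2])⟩

lemma integrable_bellman_of_mem {f : ℝ → ℝ} (hm : Measurable f) {k : ℕ}
    (hf : ∀ y, f y ∈ Set.Icc (0 : ℝ) k) (y : ℝ) : Integrable (bellman d f y) unif := by
  refine Integrable.of_bound (C := (k : ℝ) + 1)
    ((measurable_bellman hm).comp measurable_prodMk_left).aestronglyMeasurable ?_
  refine Eventually.of_forall fun u => ?_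
  have := bellman_mem (d := d) hf y u
  rw [Real.norm_of_nonneg this.1]; exact this.2

lemma value_mem (k : ℕ) (y : ℝ) : value d k y ∈ Set.Icc (0 : ℝ) k := by
  induction k generalizing y with
  | zero => simp [value]
  | succ k ih =>
    have hint := integrable_bellman_of_mem (d := d) (measurable_value k) ih y
    constructor
    · exact integral_nonneg fun u => (bellman_mem ih y u).1
    · have := integral_mono hint (integrable_const ((k : ℝ) + 1)) fun u => (bellman_mem ih y u).2
      simpa [value] using this

lemma integrable_bellman (k : ℕ) (y : ℝ) : Integrable (bellman d (value d k) y) unif :=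
  integrable_bellman_of_mem (measurable_value k) (value_mem k) y

lemma value_succ (k : ℕ) (y : ℝ) :
    value d (k + 1) y = ∫ u, bellman d (value d k) y u ∂unif := rfl

lemma value_succ_le {k : ℕ} {y : ℝ} {g : ℝ → ℝ} (hg : Integrable g unif)
    (h : ∀ u ∈ Set.Icc (0 : ℝ) 1, bellman d (value d k) y u ≤ g u) :
    value d (k + 1) y ≤ ∫ u, g u ∂unif :=
  integral_mono_ae (integrable_bellman k y) hg (ae_unif_mem.mono h)

lemma le_value_succ {k : ℕ} {y : ℝ} {g : ℝ → ℝ} (hg : Integrable g unif)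
    (h : ∀ u ∈ Set.Icc (0 : ℝ) 1, g u ≤ bellman d (value d k) y u) :
    ∫ u, g u ∂unif ≤ value d (k + 1) y :=
  integral_mono_ae hg (integrable_bellman k y) (ae_unif_mem.mono h)

lemma bellman_anti {f : ℝ → ℝ} (hf : AntitoneOn f (Set.Ici 0)) {y y' u : ℝ} (hy : 0 ≤ y)
    (h : y ≤ y') (hu : u ∈ Set.Icc (0 : ℝ) 1) : bellman d f y' u ≤ bellman d f y u := by
  have hn := nextPos_mono hy h hu
  have h0 : 0 ≤ nextPos y u := hy.trans (le_nextPos hu)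
  refine bellman_le ((hf hy (hy.trans h) h).trans (le_bellman f y u)) fun h' => ?_
  have := hf h0 (h0.trans hn) hn
  linarith [one_add_le_bellman (d := d) f (hn.trans h')]

lemma value_antitoneOn (k : ℕ) : AntitoneOn (value d k) (Set.Ici 0) := by
  induction k with
  | zero => exact antitoneOn_const
  | succ k ih =>
    intro y hy y' _ h
    exact value_succ_le (integrable_bellman k y) fun u hu => bellman_anti ih hy h hu

lemma value_le_succ (k : ℕ) (y : ℝ) : value d k y ≤ value d (k + 1) y := by
  have := le_value_succ (d := d) (k := k) (y := y) (integrable_const (value d k y))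
    fun u _ => le_bellman _ y u
  simpa using this

lemma value_mono (y : ℝ) : Monotone (fun k => value d k y) :=
  monotone_nat_of_le_succ fun k => value_le_succ k y

/-- If at least `k` entire blocks are left, all of the next `k` observations can be selected,
whatever they are. Below this threshold the value is constant in the position. -/
lemma value_eq_of_ceil_add_le {k : ℕ} {y : ℝ} (hy : 0 ≤ y) (h : ⌈y⌉₊ + k ≤ d + 1) :
    value d k y = k := by
  induction k generalizing y with
  | zero => simp [value]
  | succ k ih =>
    refine le_antisymm (value_mem _ _).2 ?_
    have := le_value_succ (d := d) (k := k) (y := y) (integrable_const ((k : ℝ) + 1)) ?_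
    · simpa using this
    intro u hu
    have hn := nextPos_le_ceil hy hu
    have h1 : ⌈nextPos y u⌉₊ ≤ ⌈y⌉₊ + 1 := by
      rw [Nat.ceil_le]; exact_mod_cast hn
    have h2 : nextPos y u ≤ d + 1 := by
      have : ((⌈y⌉₊ + 1 : ℕ) : ℝ) ≤ ((d + 1 : ℕ) : ℝ) := by exact_mod_cast (by omega)
      push_cast at this; linarith
    have h3 := ih (hy.trans (le_nextPos hu)) (by omega)
    linarith [one_add_le_bellman (value d k) h2]

/-- Beyond the threshold of `value_eq_of_ceil_add_le` the value is strictly decreasing. An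
observation that lies in the block of `y'`, shortly before `y'`, separates `y` from `y'`: the former
position can still collect it on the way, the latter only across the next turn. -/
lemma value_lt_value {k : ℕ} {y y' : ℝ} (hy : 0 ≤ y) (h : y < y') (h' : y' ≤ d + 1)
    (hk : (d : ℝ) + 1 < y' + k) : value d k y' < value d k y := by
  induction k generalizing y y' with
  | zero => simp at hk; linarith
  | succ k ih =>
    have hle : value d (k + 1) y' ≤ value d (k + 1) y :=
      value_antitoneOn (k + 1) hy (hy.trans h.le) h.le
    refine lt_of_le_of_ne hle fun heq => ?_
    have hsub : 0 =ᵐ[unif] fun u => bellman d (value d k) y u - bellman d (value d k) y' u := by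
      refine ((integral_eq_zero_iff_of_nonneg_ae ?_
        ((integrable_bellman k y).sub (integrable_bellman k y'))).1 ?_).symm
      · filter_upwards [ae_unif_mem] with u hu
        exact sub_nonneg.2 (bellman_anti (value_antitoneOn k) hy h.le hu)
      · rw [integral_sub' (integrable_bellman k y) (integrable_bellman k y'), ← value_succ,
          ← value_succ, heq, sub_self]
    -- the block that ends at or after `y'` and contains points just below `y'`
    obtain ⟨e, he⟩ : ∃ e : ℕ, ⌈y'⌉₊ = e + 1 :=
      Nat.exists_eq_succ_of_ne_zero (Nat.ceil_pos.2 (hy.trans_lt h)).ne'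
    have he1 : y' ≤ e + 1 := by have := Nat.le_ceil y'; rw [he] at this; exact_mod_cast this
    have he2 : (e : ℝ) < y' := Nat.lt_ceil.1 (by omega)
    have he3 : (d : ℝ) + 1 ≤ e + 1 + k := by
      have : (d : ℝ) + 1 < ((e + 1 + (k + 1) : ℕ) : ℝ) := by
        push_cast at hk ⊢; linarith
      have : d + 1 < e + 1 + (k + 1) := by exact_mod_cast this
      have : d + 1 ≤ e + 1 + k := by omega
      exact_mod_cast this
    have key : ∀ u ∈ Set.Icc (0 : ℝ) 1, max y e < pathPos e u → pathPos e u < y' →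
        bellman d (value d k) y' u < bellman d (value d k) y u := by
      intro u hu hu1 hu2
      have hp1 : y < pathPos e u := (le_max_left _ _).trans_lt hu1
      have hp0 : 0 ≤ pathPos e u := hy.trans hp1.le
      have hn : nextPos y u ≤ pathPos e u := nextPos_le hy hu hp1.le
      have hn0 : 0 ≤ nextPos y u := hy.trans (le_nextPos hu)
      have hacc := one_add_le_bellman (d := d) (value d k) (hn.trans (hu2.le.trans h'))
      have hv1 : value d k (pathPos e u) ≤ value d k (nextPos y u) :=
        value_antitoneOn k hn0 hp0 hn
      have hv2 : value d k y' ≤ value d k (pathPos e u) :=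
        value_antitoneOn k hp0 (hp0.trans hu2.le) hu2.le
      refine bellman_lt (by linarith) fun hz => ?_
      -- from `y'` the observation can only be reached on the other side of the next turn
      have hz1 : (e : ℝ) + 1 < nextPos y' u := by
        have hmid : (e : ℝ) + 1 < pathPos (e + 1) u := by rw [pathPos_succ]; linarith
        by_contra! hcon
        have hge : y' ≤ nextPos y' u := le_nextPos hu
        have hb : nextPos y' u = pathPos (nextBlock y' u) u := rfl
        have hb1 := le_pathPos (b := nextBlock y' u) hu
        have hb2 := pathPos_le (b := nextBlock y' u) hu
        have hne : nextBlock y' u ≠ e := by intro h; rw [h] at hb; linarith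
        have hne' : nextBlock y' u ≠ e + 1 := by intro h; rw [h] at hb; linarith
        rcases Nat.lt_or_ge (nextBlock y' u) e with hlt | hge'
        · have : ((nextBlock y' u : ℕ) : ℝ) + 1 ≤ e := by exact_mod_cast hlt
          linarith
        · have : (e : ℝ) + 2 ≤ (nextBlock y' u : ℕ) := by exact_mod_cast (by omega)
          linarith
      have := ih hp0 (by linarith : pathPos e u < nextPos y' u) hz (by linarith)
      linarith
    -- such observations have positive probability
    have hmem : ∃ u ∈ Set.Icc (0 : ℝ) 1, max y e < pathPos e u ∧ pathPos e u < y' ∧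
        bellman d (value d k) y u - bellman d (value d k) y' u = 0 := by
      have hpos : volume (Set.Ioo (max y e) y') ≠ 0 := by
        simp [Real.volume_Ioo, h, he2]
      have hpos' : volume ((pathPos e) ⁻¹' Set.Ioo (max y e) y') ≠ 0 := by
        have hmp : MeasurePreserving (pathPos e) volume volume := by
          unfold pathPos
          split_ifs
          · exact measurePreserving_add_left volume (e : ℝ)
          · exact (measurePreserving_add_left volume (e : ℝ)).comp
              (Measure.measurePreserving_sub_left volume (1 : ℝ))
        rwa [hmp.measure_preimage measurableSet_Ioo.nullMeasurableSet]
      have hae : ∀ᵐ u ∂volume, u ∈ Set.Icc (0 : ℝ) 1 →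
          bellman d (value d k) y u - bellman d (value d k) y' u = 0 :=
        ((ae_restrict_iff' measurableSet_Icc).1 hsub).mono fun u hu hu' => (hu hu').symm
      by_contra! hcon
      refine hpos' (measure_mono_null ?_ (ae_iff.1 hae))
      intro u hu
      have hIcc : u ∈ Set.Icc (0 : ℝ) 1 := by
        have h1 := (le_max_right y e).trans_lt hu.1
        have h2 := hu.2
        unfold pathPos at h1 h2
        split_ifs at h1 h2 <;> constructor <;> linarith
      exact fun hcon' => hcon u hIcc hu.1 hu.2 (hcon' hIcc)
    obtain ⟨u, hu, hu1, hu2, hu3⟩ := hmem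
    linarith [key u hu hu1 hu2]

/-- Given the position, accepting and rejecting are almost surely not equally good: equality forces
the next position to be the only one with a given value below `k`. -/
lemma ae_unif_no_tie (k : ℕ) {y : ℝ} (hy : 0 ≤ y) :
    ∀ᵐ u ∂unif, nextPos y u ≤ d + 1 → 1 + value d k (nextPos y u) ≠ value d k y := by
  by_cases hex : ∃ z, 0 ≤ z ∧ z ≤ (d : ℝ) + 1 ∧ 1 + value d k z = value d k y
  · obtain ⟨z, hz0, hz1, hz⟩ := hex
    filter_upwards [ae_unif_mem, ae_unif_nextPos_ne y z] with u hu hne hle heq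
    have hlt : ∀ w, 0 ≤ w → 1 + value d k w = value d k y → (d : ℝ) + 1 < w + k := by
      intro w hw hw'
      by_contra! hcon
      have hc : ⌈w⌉₊ + k ≤ d + 1 := by
        have hkd : k ≤ d + 1 := by
          have : (k : ℝ) ≤ ((d + 1 : ℕ) : ℝ) := by push_cast; linarith
          exact_mod_cast this
        have : ⌈w⌉₊ ≤ d + 1 - k := by
          rw [Nat.ceil_le, Nat.cast_sub hkd]; push_cast; linarith
        omega
      have := (value_mem (d := d) k y).2
      rw [← hw', value_eq_of_ceil_add_le hw hc] at this
      linarith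
    have hn0 : 0 ≤ nextPos y u := hy.trans (le_nextPos hu)
    rcases lt_or_gt_of_ne hne with h | h
    · have := value_lt_value hn0 h hz1 (hlt z hz0 hz)
      linarith
    · have := value_lt_value hz0 h hle (hlt _ hn0 heq)
      linarith
  · filter_upwards [ae_unif_mem] with u hu hle heq
    exact hex ⟨_, hy.trans (le_nextPos hu), hle, heq⟩

end Value

/-! ### The upper bound -/

section UpperBound

variable {d : ℕ}

lemma integral_max_one_sub_le {c : ℝ} (hc : 0 < c) (y : ℝ) :
    ∫ z in y..(y + 1), max 0 (1 - c * (z - y)) ≤ 1 / (2 * c) := by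
  have hcont : Continuous fun z : ℝ => max 0 (1 - c * z) := by fun_prop
  have hlin : ∀ t : ℝ, ∫ z in (0 : ℝ)..t, (1 - c * z) = t - c * t ^ 2 / 2 := by
    intro t
    have h1 : ∫ z in (0 : ℝ)..t, c * z = c * (t ^ 2 / 2) := by
      rw [intervalIntegral.integral_const_mul, integral_id]; ring
    rw [intervalIntegral.integral_sub (by simp) (by apply Continuous.intervalIntegrable; fun_prop),
      h1]
    simp; ring
  have h0 : ∫ z in y..(y + 1), max 0 (1 - c * (z - y)) = ∫ z in (0 : ℝ)..1, max 0 (1 - c * z) := by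
    rw [intervalIntegral.integral_comp_sub_right (fun z => max 0 (1 - c * z)) y]; simp
  rw [h0]
  have hc' : 0 < 1 / c := by positivity
  have hstep : ∀ t : ℝ, 0 ≤ t → t ≤ 1 / c →
      ∫ z in (0 : ℝ)..t, max 0 (1 - c * z) = t - c * t ^ 2 / 2 := by
    intro t ht ht'
    rw [← hlin]
    refine intervalIntegral.integral_congr fun z hz => ?_
    rw [Set.uIcc_of_le ht] at hz
    have : c * z ≤ 1 := by
      have := mul_le_mul_of_nonneg_left (hz.2.trans ht') hc.le
      rwa [mul_one_div_cancel hc.ne'] at this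
    exact max_eq_right (by linarith)
  rcases le_total 1 (1 / c) with h | h
  · rw [hstep 1 zero_le_one h, le_div_iff₀ (by positivity)]
    nlinarith [sq_nonneg (c - 1)]
  · rw [← intervalIntegral.integral_add_adjacent_intervals (b := 1 / c)
      (hcont.intervalIntegrable _ _) (hcont.intervalIntegrable _ _), hstep _ hc'.le le_rfl]
    have : ∫ z in (1 / c)..1, max 0 (1 - c * z) = ∫ z in (1 / c)..1, (0 : ℝ) := by
      refine intervalIntegral.integral_congr fun z hz => ?_
      rw [Set.uIcc_of_le h] at hz
      have := mul_le_mul_of_nonneg_left hz.1 hc.le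
      rw [mul_one_div_cancel hc.ne'] at this
      exact max_eq_left (by linarith)
    rw [this]
    simp only [intervalIntegral.integral_zero, add_zero]
    apply le_of_eq; field_simp; ring

/-- Closing the gap after the turn can only increase the mean of an antitone function. -/
lemma integral_nextPos_le_of_antitone {y : ℝ} (hy : 0 ≤ y) {ψ : ℝ → ℝ} (hψ : Antitone ψ) :
    ∫ u, ψ (nextPos y u) ∂unif ≤ ∫ z in y..(y + 1), ψ z := by
  have hi : ∀ a c, IntervalIntegrable ψ volume a c := fun a c => hψ.intervalIntegrable
  rw [integral_nextPos hy hi]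
  have h1 : (⌊y⌋₊ : ℝ) ≤ y := Nat.floor_le hy
  have h2 : y < ⌊y⌋₊ + 1 := Nat.lt_floor_add_one y
  set b : ℝ := (⌊y⌋₊ : ℝ)
  rw [← intervalIntegral.integral_add_adjacent_intervals (a := y) (b := b + 1) (c := y + 1)
    (hi _ _) (hi _ _)]
  have : ∫ z in (2 * (b + 1) - y)..(b + 2), ψ z =
      ∫ z in (b + 1)..(y + 1), ψ (z + (b + 1 - y)) := by
    rw [intervalIntegral.integral_comp_add_right]; congr 1 <;> ring
  rw [this]
  gcongr
  refine intervalIntegral.integral_mono_on (by linarith) ?_ (hi _ _) fun z _ => hψ (by linarith)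
  exact (hψ.comp_monotone (fun _ _ h => by simpa using h)).intervalIntegrable

lemma integrable_unif_of_continuous_nextPos {ψ : ℝ → ℝ} (hψ : Continuous ψ) {y : ℝ}
    (hy : 0 ≤ y) : Integrable (fun u => ψ (nextPos y u)) unif := by
  obtain ⟨C, hC⟩ := (isCompact_Icc (a := 0) (b := (⌈y⌉₊ : ℝ) + 1)).exists_bound_of_continuousOn
    hψ.continuousOn
  refine Integrable.of_bound (C := C)
    (hψ.measurable.comp (measurable_nextPos.comp measurable_prodMk_left)).aestronglyMeasurable ?_
  filter_upwards [ae_unif_mem] with u hu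
  exact hC _ ⟨hy.trans (le_nextPos hu), nextPos_le_ceil hy hu⟩

/-- For each slope `c`, a linear function of the remaining length is a supersolution of the dynamic
programming equation. Optimizing over `c` plays the part of the Cauchy–Schwarz inequality. -/
lemma value_lt_linear {c : ℝ} (hc : 0 < c) (k : ℕ) {y : ℝ} (hy : 0 ≤ y) (hyd : y < d + 1) :
    value d k y < c * (d + 1 - y) + k * (1 / (2 * c)) := by
  induction k generalizing y with
  | zero => simp [value]; exact mul_pos hc (by linarith)
  | succ k ih =>
    set g : ℝ → ℝ := fun z => (c * (d + 1 - y) + k * (1 / (2 * c))) + max 0 (1 - c * (z - y))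
    have hgc : Continuous g := by fun_prop
    have hg := integrable_unif_of_continuous_nextPos hgc hy
    have hlt : ∀ᵐ u ∂unif, bellman d (value d k) y u < g (nextPos y u) := by
      filter_upwards [ae_unif_mem, ae_unif_nextPos_ne y (d + 1)] with u hu hne
      refine bellman_lt ?_ fun hle => ?_
      · have := le_max_left 0 (1 - c * (nextPos y u - y))
        linarith [ih hy hyd]
      · have := le_max_right 0 (1 - c * (nextPos y u - y))
        have := ih (hy.trans (le_nextPos hu)) (lt_of_le_of_ne hle hne)
        simp only [g]
        linarith
    have h1 : value d (k + 1) y < ∫ u, g (nextPos y u) ∂unif := by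
      rw [value_succ]
      refine lt_of_le_of_ne (integral_mono_ae (integrable_bellman k y) hg
        (hlt.mono fun u hu => hu.le)) fun heq => ?_
      have := (integral_eq_iff_of_ae_le (integrable_bellman k y) hg
        (hlt.mono fun u hu => hu.le)).1 heq
      obtain ⟨u, hu1, hu2⟩ := (this.and hlt).exists
      exact hu2.ne hu1
    have hanti : Antitone fun z => max 0 (1 - c * (z - y)) := fun a b hab =>
      max_le_max le_rfl (by nlinarith)
    have h2 := integral_nextPos_le_of_antitone hy hanti
    have h3 := integral_max_one_sub_le hc y
    have h4 : ∫ u, g (nextPos y u) ∂unif = (c * (d + 1 - y) + k * (1 / (2 * c))) +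
        ∫ u, max 0 (1 - c * (nextPos y u - y)) ∂unif := by
      simp only [g]
      rw [integral_add (integrable_const _)
        (integrable_unif_of_continuous_nextPos (ψ := fun z => max 0 (1 - c * (z - y)))
          (by fun_prop) hy)]
      simp
    push_cast
    linarith

/-- The upper bound. The slope is the one that balances the two terms of `value_lt_linear`. -/
theorem value_lt_sqrt {n : ℕ} (hn : 1 ≤ n) :
    value d n 0 < √(2 * (d + 1)) * √n := by
  have hn' : (0 : ℝ) < n := by exact_mod_cast hn
  have hs : 0 < √(2 * ((d : ℝ) + 1)) := by positivity
  have hs2 : √(2 * ((d : ℝ) + 1)) ^ 2 = 2 * (d + 1) := Real.sq_sqrt (by positivity)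
  have ht : 0 < √(n : ℝ) := by positivity
  have ht2 : √(n : ℝ) ^ 2 = n := Real.sq_sqrt hn'.le
  have := value_lt_linear (d := d) (c := √n / √(2 * (d + 1))) (by positivity) n le_rfl
    (by positivity)
  refine this.trans_eq ?_
  set s := √(2 * ((d : ℝ) + 1))
  set t := √(n : ℝ)
  have hd : (d : ℝ) + 1 = s ^ 2 / 2 := by linarith
  rw [sub_zero, hd, ← ht2]
  field_simp
  ring

end UpperBound

/-! ### A single block -/

/-- A lower bound for the mean number of selections within a single block, as a function of the
number of observations times the length of what is left of the block. -/
noncomputable def profile (x : ℝ) : ℝ := √2 * (√x - √√x)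

/-- The positive part of `profile`. -/
noncomputable def profilePos (x : ℝ) : ℝ := max 0 (profile x)

lemma continuous_profile : Continuous profile := by unfold profile; fun_prop

lemma continuous_profilePos : Continuous profilePos := continuous_const.max continuous_profile

lemma profile_eq {w : ℝ} (hw : 0 ≤ w) : profile (w ^ 4) = √2 * (w ^ 2 - w) := by
  have : √(w ^ 4) = w ^ 2 := by
    rw [show w ^ 4 = (w ^ 2) ^ 2 by ring]; exact Real.sqrt_sq (by positivity)
  rw [profile, this, Real.sqrt_sq hw]

lemma exists_pow_four {x : ℝ} (hx : 0 ≤ x) : ∃ w, 0 ≤ w ∧ w ^ 4 = x :=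
  ⟨√√x, by positivity, by
    rw [show √√x ^ 4 = (√√x ^ 2) ^ 2 by ring, Real.sq_sqrt (Real.sqrt_nonneg _), Real.sq_sqrt hx]⟩

/-- The derivative of `profile` is at most `1 / 2`. -/
lemma profile_add_le {x r : ℝ} (hx : 0 ≤ x) (hr : 0 ≤ r) : profile (x + r) ≤ profile x + r / 2 := by
  obtain ⟨w, hw, rfl⟩ := exists_pow_four hx
  obtain ⟨v, hv, hvr⟩ := exists_pow_four (add_nonneg hx hr)
  rw [← hvr, profile_eq hw, profile_eq hv]
  have hwv : w ≤ v := by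
    by_contra! h
    have : v ^ 4 < w ^ 4 := pow_lt_pow_left₀ h hv (by norm_num)
    linarith
  have hr' : r = v ^ 4 - w ^ 4 := by linarith
  have h2 : √2 ^ 2 = 2 := Real.sq_sqrt (by norm_num)
  have h3 : 0 < √2 := by positivity
  have h4 : √2 ≤ 1.4143 := by rw [Real.sqrt_le_left (by norm_num)]; norm_num
  have h5 : 1.4142 ≤ √2 := Real.le_sqrt_of_sq_le (by norm_num)
  set q := √2
  -- the difference quotient is at least `σ ^ 3 / 4 - √2 * σ + √2` with `σ = v + w`
  have key : 0 ≤ (v + w) ^ 3 / 4 - q * (v + w) + q := by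
    have hs : 0 ≤ v + w := by linarith
    set σ := v + w
    -- `1.37` is close to the minimizer `√(4 * √2 / 3)` of the cubic
    have : 0 ≤ (σ - 1.37) ^ 2 * (σ + 2.74) := by positivity
    nlinarith
  have : 0 ≤ (v - w) * ((v + w) * (v ^ 2 + w ^ 2) / 2 - q * (v + w) + q) := by
    refine mul_nonneg (by linarith) ?_
    nlinarith [mul_nonneg (add_nonneg hv hw) (sq_nonneg (v - w))]
  rw [hr']
  nlinarith

lemma profilePos_add_le {x r : ℝ} (hx : 0 ≤ x) (hr : 0 ≤ r) :
    profilePos (x + r) ≤ profilePos x + r / 2 := by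
  unfold profilePos
  refine max_le (by positivity) ((profile_add_le hx hr).trans ?_)
  gcongr; exact le_max_right _ _

/-- The increase of `profile` is at most what the acceptance window of relative length
`√2 / w ^ 2` yields in `profilePos_add_le_integral`. The terms of leading order cancel; the
fourth root in `profile` pays for the term `2 / (3 * w ^ 4)`. -/
lemma profile_add_le_of_large {w r : ℝ} (hw : 1.27 ≤ w) (hr : 0 ≤ r) (hr1 : r ≤ 1) :
    profile (w ^ 4 + r) ≤ profile (w ^ 4) +
      r * (√2 / (2 * w ^ 2) - 2 / (3 * w ^ 4) + √2 / (4 * w ^ 3)) := by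
  have hw0 : 0 < w := by linarith
  obtain ⟨v, hv, hvr⟩ := exists_pow_four (show 0 ≤ w ^ 4 + r by positivity)
  rw [← hvr, profile_eq hw0.le, profile_eq hv]
  have hwv : w ≤ v := by
    by_contra! h
    have : v ^ 4 < w ^ 4 := pow_lt_pow_left₀ h hv (by norm_num)
    linarith
  have hv0 : 0 < v := by linarith
  have hw4 : (1.27 : ℝ) ^ 4 ≤ w ^ 4 := by gcongr
  have hv11 : v ≤ 1.1 * w := by
    by_contra! h
    have : (1.1 * w) ^ 4 < v ^ 4 := pow_lt_pow_left₀ h (by positivity) (by norm_num)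
    rw [mul_pow] at this
    norm_num at this hw4
    linarith
  have hv3 : v ^ 3 ≤ 4 / 3 * w ^ 3 := by
    calc v ^ 3 ≤ (1.1 * w) ^ 3 := by gcongr
      _ = 1.331 * w ^ 3 := by ring
      _ ≤ 4 / 3 * w ^ 3 := by gcongr; norm_num
  have hr' : r = (v - w) * ((v + w) * (v ^ 2 + w ^ 2)) := by linear_combination hvr.symm
  have h1 : v ^ 2 - w ^ 2 ≤ r / (2 * w ^ 2) := by
    rw [le_div_iff₀ (by positivity)]
    have : 0 ≤ (v - w) * (v + w) * (v ^ 2 - w ^ 2) := by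
      apply mul_nonneg (mul_nonneg (by linarith) (by linarith)); nlinarith
    nlinarith
  have h2 : r * (3 / (16 * w ^ 3)) ≤ v - w := by
    have hle : (v + w) * (v ^ 2 + w ^ 2) ≤ 16 / 3 * w ^ 3 := by
      calc (v + w) * (v ^ 2 + w ^ 2) ≤ (v + v) * (v ^ 2 + v ^ 2) := by gcongr
        _ = 4 * v ^ 3 := by ring
        _ ≤ _ := by linarith
    calc r * (3 / (16 * w ^ 3)) ≤ (v - w) * (16 / 3 * w ^ 3) * (3 / (16 * w ^ 3)) := by
          rw [hr']; gcongr
      _ = v - w := by field_simp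
  have h5 : 1.4 ≤ √2 := Real.le_sqrt_of_sq_le (by norm_num)
  have h6 : √2 * (v ^ 2 - w ^ 2) ≤ √2 * (r / (2 * w ^ 2)) := by gcongr
  have h7 : √2 * (r * (3 / (16 * w ^ 3))) ≤ √2 * (v - w) := by gcongr
  have h8 : 2 / (3 * w ^ 4) ≤ √2 / (4 * w ^ 3) + √2 * (3 / (16 * w ^ 3)) := by
    have : √2 / (4 * w ^ 3) + √2 * (3 / (16 * w ^ 3)) = (7 / 16 * √2 * w) / w ^ 4 := by
      field_simp; ring
    rw [this, show 2 / (3 * w ^ 4) = (2 / 3) / w ^ 4 by field_simp]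
    gcongr
    nlinarith
  have h9 := mul_le_mul_of_nonneg_left h8 hr
  have : √2 * (r / (2 * w ^ 2)) = r * (√2 / (2 * w ^ 2)) := by ring
  linarith

lemma one_sub_sub_le_sqrt {z : ℝ} (hz : 0 ≤ z) : 1 - z / 2 - z ^ 2 / 2 ≤ √(1 - z) := by
  rcases le_total z 1 with h | h
  · refine Real.le_sqrt_of_sq_le ?_
    nlinarith [mul_nonneg (sq_nonneg z) (sub_nonneg.2 h), mul_nonneg hz hz,
      mul_nonneg (mul_nonneg (sq_nonneg z) hz) (sub_nonneg.2 h)]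
  · have := Real.sqrt_nonneg (1 - z)
    nlinarith

lemma le_profile_mul {w z : ℝ} (hw : 0 ≤ w) (hz : 0 ≤ z) (hz1 : z ≤ 1) :
    profile (w ^ 4) - √2 * w ^ 2 * (z / 2 + z ^ 2 / 2) + √2 * w * (z / 4) ≤
      profile (w ^ 4 * (1 - z)) := by
  obtain ⟨t, ht, htz⟩ := exists_pow_four (sub_nonneg.2 hz1)
  have h1 := one_sub_sub_le_sqrt hz
  rw [← htz, ← mul_pow, profile_eq hw, profile_eq (by positivity)]
  have h2 : √(t ^ 4) = t ^ 2 := by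
    rw [show t ^ 4 = (t ^ 2) ^ 2 by ring]; exact Real.sqrt_sq (by positivity)
  rw [← htz, h2] at h1
  have h3 : t ≤ 1 - z / 4 := by
    nlinarith [sq_nonneg (t ^ 2 - 1), sq_nonneg (t - 1)]
  have h4 : 0 ≤ √2 := by positivity
  have h5 := mul_le_mul_of_nonneg_left h1 (show 0 ≤ √2 * w ^ 2 by positivity)
  have h6 := mul_le_mul_of_nonneg_left h3 (show 0 ≤ √2 * w by positivity)
  nlinarith

/-- Within a block, `profilePos` is a subsolution of the dynamic programming equation. -/
lemma profilePos_add_le_integral (m : ℕ) {r : ℝ} (hr : 0 ≤ r) (hr1 : r ≤ 1) :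
    profilePos ((m + 1) * r) ≤ profilePos (m * r) +
      ∫ s in (0 : ℝ)..r, max 0 (1 + profilePos (m * (r - s)) - profilePos (m * r)) := by
  have hX : 0 ≤ m * r := by positivity
  have hcont : Continuous fun s : ℝ =>
      max 0 (1 + profilePos (m * (r - s)) - profilePos (m * r)) := by
    have := continuous_profilePos
    fun_prop
  rw [add_mul, one_mul]
  rcases le_total (profilePos (m * r)) (1 / 2) with h | h
  · -- a small profile: every observation in the block is acceptable
    have h1 : ∫ s in (0 : ℝ)..r, (1 / 2 : ℝ) ≤
        ∫ s in (0 : ℝ)..r, max 0 (1 + profilePos (m * (r - s)) - profilePos (m * r)) := by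
      refine intervalIntegral.integral_mono_on hr (by simp) (hcont.intervalIntegrable _ _) ?_
      intro s _
      refine le_max_of_le_right ?_
      have : 0 ≤ profilePos (m * (r - s)) := le_max_left _ _
      linarith
    have h2 : ∫ s in (0 : ℝ)..r, (1 / 2 : ℝ) = r / 2 := by simp; ring
    linarith [profilePos_add_le hX hr]
  · obtain ⟨w, hw, hwX⟩ := exists_pow_four hX
    have hpos : profilePos (m * r) = profile (w ^ 4) := by
      rw [hwX]; exact max_eq_right (by
        by_contra! hc
        have : profilePos (m * r) = 0 := max_eq_left hc.le
        linarith)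
    have hq2 : √2 ^ 2 = 2 := Real.sq_sqrt (by norm_num)
    have hq3 : √2 ≤ 1.4143 := by rw [Real.sqrt_le_left (by norm_num)]; norm_num
    have hw127 : 1.27 ≤ w := by
      rw [hpos, profile_eq hw] at h
      by_contra! hc
      have : 0 < √2 := by positivity
      rcases le_total w 1 with h1 | h1
      · nlinarith
      · nlinarith
    have hw0 : 0 < w := by linarith
    have hr0 : 0 < r := by
      rcases hr.eq_or_lt with h0 | h0
      · rw [← h0, mul_zero] at hwX
        have : 0 < w ^ 4 := by positivity
        linarith
      · exact h0
    -- the acceptance window that is optimal for the leading term `√(2 * x)` of the profile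
    set ζ : ℝ := √2 / w ^ 2 with hζ
    have hζ0 : 0 ≤ ζ := by positivity
    have hζ1 : ζ ≤ 1 := by rw [hζ, div_le_one (by positivity)]; nlinarith
    have hζw : √2 * w ^ 2 * ζ = 2 := by rw [hζ]; field_simp; exact hq2
    have hh : r * ζ ≤ r := by nlinarith
    have hh0 : 0 ≤ r * ζ := by positivity
    have hI1 : ∫ s in (0 : ℝ)..(r * ζ), max 0 (1 + profilePos (m * (r - s)) - profilePos (m * r)) ≤
        ∫ s in (0 : ℝ)..r, max 0 (1 + profilePos (m * (r - s)) - profilePos (m * r)) := by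
      refine intervalIntegral.integral_mono_interval le_rfl hh0 hh ?_ (hcont.intervalIntegrable _ _)
      exact Eventually.of_forall fun s => le_max_left _ _
    have hI2 : ∫ s in (0 : ℝ)..(r * ζ), (1 - √2 * w ^ 2 * ((s / r) / 2 + (s / r) ^ 2 / 2) +
          √2 * w * ((s / r) / 4)) ≤
        ∫ s in (0 : ℝ)..(r * ζ), max 0 (1 + profilePos (m * (r - s)) - profilePos (m * r)) := by
      refine intervalIntegral.integral_mono_on hh0
        (by apply Continuous.intervalIntegrable; fun_prop) (hcont.intervalIntegrable _ _) ?_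
      intro s hs
      refine le_max_of_le_right ?_
      have hz0 : 0 ≤ s / r := div_nonneg hs.1 hr
      have hz1 : s / r ≤ 1 := by rw [div_le_one hr0]; exact hs.2.trans hh
      have h1 := le_profile_mul hw hz0 hz1
      have h2 : w ^ 4 * (1 - s / r) = m * (r - s) := by rw [hwX]; field_simp
      have h3 : profile (m * (r - s)) ≤ profilePos (m * (r - s)) := le_max_right _ _
      rw [hpos]
      rw [h2] at h1
      linarith
    have hI3 : ∫ s in (0 : ℝ)..(r * ζ), (1 - √2 * w ^ 2 * ((s / r) / 2 + (s / r) ^ 2 / 2) +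
          √2 * w * ((s / r) / 4)) =
        r * (ζ - √2 * w ^ 2 * (ζ ^ 2 / 4 + ζ ^ 3 / 6) + √2 * w * (ζ ^ 2 / 8)) := by
      have e : ∀ s : ℝ, (1 - √2 * w ^ 2 * ((s / r) / 2 + (s / r) ^ 2 / 2) +
          √2 * w * ((s / r) / 4)) = 1 + (√2 * w / (4 * r) - √2 * w ^ 2 / (2 * r)) * s -
            (√2 * w ^ 2 / (2 * r ^ 2)) * s ^ 2 := by
        intro s; field_simp; ring
      simp_rw [e]
      rw [intervalIntegral.integral_sub (by apply Continuous.intervalIntegrable; fun_prop)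
        (by apply Continuous.intervalIntegrable; fun_prop),
        intervalIntegral.integral_add (by simp) (by apply Continuous.intervalIntegrable; fun_prop),
        intervalIntegral.integral_const_mul, intervalIntegral.integral_const_mul]
      simp only [intervalIntegral.integral_const, integral_id, integral_pow]
      simp
      field_simp
      ring
    have hfin : r * (ζ - √2 * w ^ 2 * (ζ ^ 2 / 4 + ζ ^ 3 / 6) + √2 * w * (ζ ^ 2 / 8)) =
        r * (√2 / (2 * w ^ 2) - 2 / (3 * w ^ 4) + √2 / (4 * w ^ 3)) := by
      have e1 : √2 * w ^ 2 * (ζ ^ 2 / 4 + ζ ^ 3 / 6) = ζ / 2 + ζ ^ 2 / 3 := by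
        linear_combination (ζ / 4 + ζ ^ 2 / 6) * hζw
      have e2 : ζ ^ 2 = 2 / w ^ 4 := by rw [hζ, div_pow, hq2]; ring
      rw [e1, e2, hζ]
      field_simp
      ring
    have hlarge := profile_add_le_of_large hw127 hr hr1
    have : profilePos (m * r + r) ≤ profile (w ^ 4 + r) ⊔ 0 := by
      rw [hwX, sup_comm]; exact le_rfl
    have hRHS : 0 ≤ profilePos (m * r) + ∫ s in (0 : ℝ)..r,
        max 0 (1 + profilePos (m * (r - s)) - profilePos (m * r)) := by
      refine add_nonneg (le_max_left _ _)
        (intervalIntegral.integral_nonneg hr fun s _ => le_max_left _ _)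
    refine this.trans (sup_le ?_ hRHS)
    linarith

/-! ### The lower bound -/

section LowerBound

variable {d : ℕ}

lemma profilePos_zero : profilePos 0 = 0 := by simp [profilePos, profile]

/-- The value at a position in the block `b` is at least what `m` observations yield within this
block plus the value of the remaining `k` observations from the start of the next block. -/
lemma profilePos_add_value_le (b k m : ℕ) (hb : b ≤ d) {y : ℝ} (hy : (b : ℝ) ≤ y)
    (hy1 : y ≤ b + 1) :
    profilePos (m * (b + 1 - y)) + value d k (b + 1) ≤ value d (k + m) y := by
  have hb0 : (0 : ℝ) ≤ b := Nat.cast_nonneg b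
  induction m generalizing y with
  | zero =>
    simp only [Nat.cast_zero, zero_mul, profilePos_zero, zero_add, add_zero]
    exact value_antitoneOn k (hb0.trans hy) (by simp; linarith) hy1
  | succ m ih =>
    rcases hy1.eq_or_lt with rfl | hlt
    · simp only [sub_self, mul_zero, profilePos_zero, zero_add]
      exact value_mono _ (Nat.le_add_right k (m + 1))
    have hfl : ⌊y⌋₊ = b := (Nat.floor_eq_iff (hb0.trans hy)).2 ⟨hy, hlt⟩
    have hbd : (b : ℝ) + 1 ≤ d + 1 := by gcongr
    set r := (b : ℝ) + 1 - y with hr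
    set ψ : ℝ → ℝ := fun z => max 0 (1 + profilePos (m * (b + 1 - z)) - profilePos (m * r))
      with hψ
    have hψc : Continuous ψ := by
      have := continuous_profilePos
      fun_prop
    have hψ0 : ∀ z, 0 ≤ ψ z := fun z => le_max_left _ _
    set χ : ℝ → ℝ := (Set.Iic ((b : ℝ) + 1)).indicator ψ with hχ
    have hχ0 : ∀ z, 0 ≤ χ z := fun z => Set.indicator_nonneg (fun z _ => hψ0 z) z
    have hχi : ∀ a c, IntervalIntegrable χ volume a c := fun a c =>
      ⟨((hψc.intervalIntegrable a c).1).indicator measurableSet_Iic,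
        ((hψc.intervalIntegrable a c).2).indicator measurableSet_Iic⟩
    have hχu : Integrable (fun u => χ (nextPos y u)) unif :=
      (integrable_unif_of_continuous_nextPos hψc (hb0.trans hy)).indicator
        ((measurable_nextPos.comp measurable_prodMk_left) measurableSet_Iic)
    have h1 : ∫ u, ((profilePos (m * r) + value d k (b + 1)) + χ (nextPos y u)) ∂unif ≤
        value d (k + m + 1) y := by
      refine le_value_succ ((integrable_const _).add hχu) fun u hu => ?_
      have hn := le_nextPos (y := y) hu
      have hrej := (ih hy hlt.le).trans (le_bellman (d := d) (value d (k + m)) y u)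
      by_cases hz : nextPos y u ≤ b + 1
      · have : χ (nextPos y u) = ψ (nextPos y u) := Set.indicator_of_mem (by exact hz) _
        rw [this, hψ]
        have hacc := one_add_le_bellman (d := d) (value d (k + m)) (hz.trans hbd)
        have := ih (hy.trans hn) hz
        rcases max_cases 0 (1 + profilePos (m * (b + 1 - nextPos y u)) - profilePos (m * r))
          with h | h <;> simp only [h.1] <;> linarith
      · have : χ (nextPos y u) = 0 := Set.indicator_of_notMem (by exact hz) _
        rw [this]; linarith
    have h2 : ∫ u, ((profilePos (m * r) + value d k (b + 1)) + χ (nextPos y u)) ∂unif =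
        (profilePos (m * r) + value d k (b + 1)) + ∫ u, χ (nextPos y u) ∂unif := by
      rw [integral_add (integrable_const _) hχu]; simp
    have h3 : ∫ z in y..(b + 1), ψ z ≤ ∫ u, χ (nextPos y u) ∂unif := by
      rw [integral_nextPos (hb0.trans hy) hχi, hfl]
      have e : ∫ z in y..(b + 1), χ z = ∫ z in y..(b + 1), ψ z := by
        refine intervalIntegral.integral_congr fun z hz => ?_
        rw [Set.uIcc_of_le hy1] at hz
        exact Set.indicator_of_mem (by exact hz.2) _
      rw [e]
      have : 0 ≤ ∫ z in (2 * ((b : ℝ) + 1) - y)..(b + 2), χ z :=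
        intervalIntegral.integral_nonneg (by linarith) fun z _ => hχ0 z
      linarith
    have h4 : ∫ z in y..(b + 1), ψ z = ∫ s in (0 : ℝ)..r,
        max 0 (1 + profilePos (m * (r - s)) - profilePos (m * r)) := by
      have := intervalIntegral.integral_comp_add_left (a := 0) (b := r) ψ y
      rw [add_zero, show y + r = b + 1 by rw [hr]; ring] at this
      rw [← this]
      refine intervalIntegral.integral_congr fun s _ => ?_
      simp only [hψ]
      rw [show (b : ℝ) + 1 - (y + s) = r - s by rw [hr]; ring]
    have h5 := profilePos_add_le_integral m (r := r) (by rw [hr]; linarith) (by rw [hr]; linarith)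
    push_cast
    rw [← add_assoc k m 1]
    linarith

/-- Giving each of the last `j` blocks `m` observations of its own. -/
lemma mul_profilePos_le_value (m j : ℕ) (hj : j ≤ d + 1) :
    j * profilePos m ≤ value d (j * m) ((d + 1 - j : ℕ) : ℝ) := by
  induction j with
  | zero => simp [value]
  | succ j ih =>
    have h := profilePos_add_value_le (d := d) (d - j) (j * m) m (by omega) le_rfl (by simp)
    have e : ((d - j : ℕ) : ℝ) + 1 = ((d + 1 - j : ℕ) : ℝ) := by
      rw [show d + 1 - j = d - j + 1 by omega]; push_cast; ring
    rw [add_sub_cancel_left, mul_one, e] at h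
    rw [show d + 1 - (j + 1) = d - j by omega, show (j + 1) * m = j * m + m by ring]
    have := ih (by omega)
    push_cast
    linarith

/-- With `b ^ 4 = ⌊n / (d + 1)⌋`, this absorbs the rounding of the number of observations per block
into the coefficient `1.2` of the fourth root, which is `1` in `profile`. -/
lemma rounding_le {a b : ℝ} (hb : 1 ≤ b) (ha : 0 ≤ a) (h : a ^ 4 = b ^ 4 + 1) :
    a ^ 2 - 1.2 * a ≤ b ^ 2 - b := by
  have hb4 : (1 : ℝ) ^ 4 ≤ b ^ 4 := by gcongr
  have ha1 : 1.18 ≤ a := by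
    by_contra! hc
    have : a ^ 4 < 1.18 ^ 4 := pow_lt_pow_left₀ hc ha (by norm_num)
    norm_num at this hb4
    linarith
  have hab : b ≤ a := by
    by_contra! hc
    have : a ^ 4 < b ^ 4 := pow_lt_pow_left₀ hc ha (by norm_num)
    linarith
  have key : 5 * (a + b - 1) ≤ a * ((a + b) * (a ^ 2 + b ^ 2)) := by
    obtain ⟨s, rfl⟩ : ∃ s, b = 1 + s := ⟨b - 1, by ring⟩
    obtain ⟨t, rfl⟩ : ∃ t, a = 1.18 + t := ⟨a - 1.18, by ring⟩
    have hs : 0 ≤ s := by linarith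
    have ht : 0 ≤ t := by linarith
    have : 0 ≤ (1.18 + t) * ((1.18 + t + (1 + s)) * ((1.18 + t) ^ 2 + (1 + s) ^ 2)) -
      5 * (1.18 + t + (1 + s) - 1) := by
      ring_nf
      positivity
    linarith
  have h1 : (a - b) * ((a + b) * (a ^ 2 + b ^ 2)) = 1 := by linear_combination h
  have h2 := mul_le_mul_of_nonneg_left key (sub_nonneg.2 hab)
  have h3 : (a - b) * (a * ((a + b) * (a ^ 2 + b ^ 2))) = a := by linear_combination a * h1
  nlinarith

/-- The lower bound, with the constant `1`. -/
theorem lt_value {n : ℕ} (hn : 1 ≤ n) :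
    √(2 * (d + 1)) * √n - √(2 * (d + 1)) * √√(2 * (d + 1)) * √(Real.pi / 3) * √√n - 1
      < value d n 0 := by
  obtain ⟨p, hp, hpd⟩ := exists_pow_four (show (0 : ℝ) ≤ d + 1 by positivity)
  obtain ⟨q, hq, hqn⟩ := exists_pow_four (show (0 : ℝ) ≤ n by positivity)
  have hp0 : 0 < p := by
    rcases hp.eq_or_lt with h | h
    · rw [← h] at hpd
      have : (0 : ℝ) ≤ d := by positivity
      norm_num at hpd; linarith
    · exact h
  have sq4 : ∀ w : ℝ, 0 ≤ w → √(w ^ 4) = w ^ 2 := fun w hw => by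
    rw [show w ^ 4 = (w ^ 2) ^ 2 by ring]; exact Real.sqrt_sq (by positivity)
  have hκ : 1.2 ≤ √√2 * √(Real.pi / 3) := by
    have h1 : 1.18 ≤ √√2 := Real.le_sqrt_of_sq_le (Real.le_sqrt_of_sq_le (by norm_num))
    have h2 : 1.02 ≤ √(Real.pi / 3) := Real.le_sqrt_of_sq_le (by linarith [Real.pi_gt_d2])
    nlinarith
  have e : √(2 * ((d : ℝ) + 1)) * √n -
      √(2 * (d + 1)) * √√(2 * (d + 1)) * √(Real.pi / 3) * √√n =
      √2 * p ^ 2 * (q ^ 2 - (√√2 * √(Real.pi / 3)) * p * q) := by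
    rw [← hpd, ← hqn, Real.sqrt_mul (by norm_num), Real.sqrt_mul (by positivity), sq4 p hp,
      sq4 q hq, Real.sqrt_sq hp, Real.sqrt_sq hq]
    ring
  rw [e]
  have h0 : 0 ≤ value d n 0 := (value_mem n 0).1
  have hle : √2 * p ^ 2 * (q ^ 2 - (√√2 * √(Real.pi / 3)) * p * q) ≤
      √2 * p ^ 2 * (q ^ 2 - 1.2 * p * q) := by gcongr
  set m := n / (d + 1) with hm
  have hmlt : (n : ℝ) < (m + 1) * (d + 1) := by
    have : n < (m + 1) * (d + 1) := by
      rw [mul_comm]; exact Nat.lt_mul_div_succ n (Nat.succ_pos d)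
    exact_mod_cast this
  rcases Nat.eq_zero_or_pos m with h | h
  · -- with fewer observations than blocks the bound is negative
    have hqp : q ≤ p := by
      by_contra! hc
      have : p ^ 4 < q ^ 4 := pow_lt_pow_left₀ hc hp (by norm_num)
      rw [h] at hmlt; norm_num at hmlt; linarith
    have : √2 * p ^ 2 * (q ^ 2 - 1.2 * p * q) ≤ 0 :=
      mul_nonpos_of_nonneg_of_nonpos (by positivity) (by nlinarith)
    linarith
  · obtain ⟨b, hb, hbm⟩ := exists_pow_four (show (0 : ℝ) ≤ m by positivity)
    obtain ⟨a, ha, ham⟩ := exists_pow_four (show (0 : ℝ) ≤ m + 1 by positivity)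
    have hm1 : (1 : ℝ) ≤ m := by exact_mod_cast h
    have hb1 : 1 ≤ b := by
      by_contra! hc
      have : b ^ 4 < 1 ^ 4 := pow_lt_pow_left₀ hc hb (by norm_num)
      linarith
    have hab := rounding_le hb1 ha (by rw [ham, hbm])
    have hba : b ≤ a := by
      by_contra! hc
      have : a ^ 4 < b ^ 4 := pow_lt_pow_left₀ hc ha (by norm_num)
      linarith
    have hqa : q ≤ a * p := by
      by_contra! hc
      have : (a * p) ^ 4 < q ^ 4 := pow_lt_pow_left₀ hc (by positivity) (by norm_num)
      rw [mul_pow, ham, hpd] at this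
      linarith
    have hpq : p ≤ q := by
      by_contra! hc
      have h1 : q ^ 4 < p ^ 4 := pow_lt_pow_left₀ hc hq (by norm_num)
      have h2 : d + 1 ≤ n := (Nat.div_pos_iff.1 h).2
      have h3 : (d : ℝ) + 1 ≤ n := by exact_mod_cast h2
      linarith
    have h1 : q ^ 2 - 1.2 * p * q ≤ p ^ 2 * (a ^ 2 - 1.2 * a) := by
      have : 0 ≤ (a * p - q) * (a * p + q - 1.2 * p) :=
        mul_nonneg (by linarith) (by nlinarith)
      nlinarith
    have h2 : √2 * p ^ 2 * (q ^ 2 - 1.2 * p * q) ≤ √2 * p ^ 2 * (p ^ 2 * (b ^ 2 - b)) := by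
      gcongr
      exact h1.trans (by gcongr)
    have h3 := mul_profilePos_le_value (d := d) m (d + 1) le_rfl
    have h4 : value d ((d + 1) * m) ((d + 1 - (d + 1) : ℕ) : ℝ) ≤ value d n 0 := by
      rw [Nat.sub_self, Nat.cast_zero]
      exact value_mono 0 (Nat.mul_div_le n (d + 1))
    have h5 : √2 * p ^ 2 * (p ^ 2 * (b ^ 2 - b)) ≤ ((d + 1 : ℕ) : ℝ) * profilePos m := by
      rw [← hbm]; push_cast; rw [← hpd]
      have : profile (b ^ 4) ≤ profilePos (b ^ 4) := le_max_right _ _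
      rw [profile_eq hb] at this
      have := mul_le_mul_of_nonneg_left this (show 0 ≤ p ^ 4 by positivity)
      linarith
    linarith

end LowerBound

/-! ### The probability integral transform -/

/-- If `ν` has a continuous distribution function, then this function maps `ν` to the uniform
distribution, even where it is not strictly increasing. -/
theorem map_cdf_eq_unif (ν : Measure ℝ) [IsProbabilityMeasure ν] (h : Continuous (cdf ν)) :
    ν.map (cdf ν) = unif := by
  have hm : Measurable (cdf ν) := (monotone_cdf ν).measurable
  have : IsProbabilityMeasure (ν.map (cdf ν)) := Measure.isProbabilityMeasure_map hm.aemeasurable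
  have hex : ∀ t ∈ Set.Ioo (0 : ℝ) 1, ∃ x, cdf ν x = t := fun t ht =>
    mem_range_of_exists_le_of_exists_ge h
      (((tendsto_cdf_atBot ν).eventually (gt_mem_nhds ht.1)).exists.imp fun _ hx => hx.le)
      (((tendsto_cdf_atTop ν).eventually (lt_mem_nhds ht.2)).exists.imp fun _ hx => hx.le)
  have hreal : ∀ x, ν.real (Set.Iic x) = cdf ν x := fun x => (cdf_eq_real ν x).symm
  have key : ∀ t ∈ Set.Ico (0 : ℝ) 1, ν.real (cdf ν ⁻¹' Set.Iic t) = t := by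
    intro t ht
    apply le_antisymm
    · refine le_of_forall_gt_imp_ge_of_dense fun s hs => ?_
      rcases lt_or_ge s 1 with hs1 | hs1
      · obtain ⟨x, rfl⟩ := hex s ⟨ht.1.trans_lt hs, hs1⟩
        rw [← hreal]
        refine measureReal_mono fun z hz => ?_
        by_contra hzx
        have := monotone_cdf ν (not_le.1 hzx).le
        exact absurd (lt_of_le_of_lt hz hs) (not_lt.2 this)
      · exact measureReal_le_one.trans hs1
    · rcases ht.1.eq_or_lt with h0 | h0
      · rw [← h0]; exact measureReal_nonneg
      · obtain ⟨x, hx⟩ := hex t ⟨h0, ht.2⟩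
        conv_lhs => rw [← hx, ← hreal]
        exact measureReal_mono fun z hz => (monotone_cdf ν hz).trans_eq hx
  refine Measure.ext_of_Iic _ _ fun t => ?_
  rw [Measure.map_apply hm measurableSet_Iic, ← measureReal_eq_measureReal_iff]
  rcases lt_or_ge t 0 with ht | ht
  · have h1 : cdf ν ⁻¹' Set.Iic t = ∅ := by
      ext x; simpa using ht.trans_le (cdf_nonneg ν x)
    have h2 : unif (Set.Iic t) = 0 := by
      rw [unif, Measure.restrict_apply measurableSet_Iic]
      have : Set.Iic t ∩ Set.Icc (0 : ℝ) 1 = ∅ := by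
        ext x; simp only [Set.mem_inter_iff, Set.mem_Iic, Set.mem_Icc, Set.mem_empty_iff_false]
        constructor
        · rintro ⟨h1, h2, _⟩; linarith
        · exact False.elim
      simp [this]
    simp [h1, Measure.real, h2]
  · have h3 : unif.real (Set.Iic t) = min t 1 := by
      rw [unif, Measure.real, Measure.restrict_apply measurableSet_Iic]
      have : Set.Iic t ∩ Set.Icc (0 : ℝ) 1 = Set.Icc 0 (min t 1) := by
        ext x; simp only [Set.mem_inter_iff, Set.mem_Iic, Set.mem_Icc, le_min_iff]; tauto
      rw [this, Real.volume_Icc, sub_zero, ENNReal.toReal_ofReal (by positivity)]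
    rw [h3]
    rcases lt_or_ge t 1 with ht1 | ht1
    · rw [key t ⟨ht, ht1⟩, min_eq_left ht1.le]
    · have h1 : cdf ν ⁻¹' Set.Iic t = Set.univ := by
        ext x; simpa using (cdf_le_one ν x).trans ht1
      rw [h1, min_eq_right ht1, probReal_univ]

/-! ### Selections as movements along the path -/

/-- The position before time `i` if the observations with time in `a`, whose scores are given by
`u`, are selected: each selection moves on to the first position that has its score. -/
noncomputable def position (u : ℕ → ℝ) (a : Set ℕ) : ℕ → ℝ
  | 0 => 0
  | i + 1 => open Classical in
      if i ∈ a then nextPos (position u a i) (u i) else position u a i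

/-- A set of selected indices as a set of times. -/
def chosen {n : ℕ} (s : Finset (Fin n)) : Set ℕ := {i | ∃ h : i < n, (⟨i, h⟩ : Fin n) ∈ s}

lemma position_nonneg {u : ℕ → ℝ} (hu : ∀ i, u i ∈ Set.Icc (0 : ℝ) 1) (a : Set ℕ) (i : ℕ) :
    0 ≤ position u a i := by
  induction i with
  | zero => exact le_rfl
  | succ i ih =>
    simp only [position]
    split_ifs
    · exact ih.trans (le_nextPos (hu i))
    · exact ih

/-- A modal selection never leaves the path. Any assignment of blocks gives positions that are
weakly increasing, and moving on to the first position possible stays behind all of them. -/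
lemma position_le_of_isModal {d n : ℕ} {x : Fin n → ℝ} {s : Finset (Fin n)} (h : IsModal d x s)
    {u : ℕ → ℝ} (hu : ∀ i, u i ∈ Set.Icc (0 : ℝ) 1)
    (hux : ∀ i j : Fin n, x i ≤ x j → u i ≤ u j) (i : ℕ) :
    position u (chosen s) i ≤ d + 1 := by
  obtain ⟨b, hb1, hb2, hb3⟩ := h
  -- the positions that the given blocks assign to the selected observations are weakly increasing
  have hmono : ∀ i ∈ s, ∀ j ∈ s, i < j → pathPos (b i) (u i) ≤ pathPos (b j) (u j) := by
    intro i hi j hj hij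
    rcases (hb1 hi hj hij.le).eq_or_lt with heq | hlt
    · have := hb3 i hi j hj hij heq
      rw [← heq]
      unfold pathPos
      split_ifs with hev
      · have := hux _ _ (this.1 hev); linarith
      · have := hux _ _ (this.2 (Nat.not_even_iff_odd.1 hev)); linarith
    · have h1 := pathPos_le (b := b i) (hu i)
      have h2 := le_pathPos (b := b j) (hu j)
      have h3 : (b i : ℝ) + 1 ≤ b j := by exact_mod_cast hlt
      linarith
  have key : ∀ i : ℕ, position u (chosen s) i ≤ d + 1 ∧
      ∀ j ∈ s, i ≤ (j : ℕ) → position u (chosen s) i ≤ pathPos (b j) (u j) := by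
    intro i
    induction i with
    | zero =>
      refine ⟨by simp only [position]; positivity, fun j _ _ => ?_⟩
      exact (Nat.cast_nonneg _).trans (le_pathPos (hu j))
    | succ i ih =>
      simp only [position]
      split_ifs with hi
      · obtain ⟨hin, his⟩ := hi
        have h1 := nextPos_le (position_nonneg hu _ i) (hu i) (ih.2 ⟨i, hin⟩ his le_rfl)
        refine ⟨h1.trans ?_, fun j hj hij => h1.trans (hmono _ his j hj ?_)⟩
        · have h2 := pathPos_le (b := b ⟨i, hin⟩) (hu i)
          have h3 : (b ⟨i, hin⟩ : ℝ) ≤ d := by exact_mod_cast hb2 _ his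
          linarith
        · exact Fin.lt_def.2 hij
      · exact ⟨ih.1, fun j hj hij => ih.2 j hj (by omega)⟩
  exact (key i).1

/-! ### The optimal policy -/

/-- The optimal decision rule at the position `y`, with `k` observations still to come. It rejects
the scores that would not move the position or that would reach the end of the path: these have
probability zero. A strict move makes the selected scores in a block strictly monotone, so that the
selected observations are monotone although the distribution function may have flat parts. -/
def Accepts (d k : ℕ) (y u : ℝ) : Prop :=
  y < nextPos y u ∧ nextPos y u < d + 1 ∧ value d k y < 1 + value d k (nextPos y u)

/-- The position before time `i` under the optimal decision rule, for `n` observations. -/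
noncomputable def optPosition (d n : ℕ) (u : ℕ → ℝ) : ℕ → ℝ
  | 0 => 0
  | i + 1 => open Classical in
      if Accepts d (n - 1 - i) (optPosition d n u i) (u i)
      then nextPos (optPosition d n u i) (u i) else optPosition d n u i

open Classical in
/-- The indices selected by the optimal decision rule. -/
noncomputable def optSelected (d n : ℕ) (u : ℕ → ℝ) : Finset (Fin n) :=
  {i | Accepts d (n - 1 - i) (optPosition d n u i) (u i)}

lemma position_optSelected {d n : ℕ} (u : ℕ → ℝ) {i : ℕ} (hi : i ≤ n) :
    position u (chosen (optSelected d n u)) i = optPosition d n u i := by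
  induction i with
  | zero => rfl
  | succ i ih =>
    have : i ∈ chosen (optSelected d n u) ↔ Accepts d (n - 1 - i) (optPosition d n u i) (u i) := by
      simp [chosen, optSelected, Nat.lt_of_succ_le hi]
    simp only [position, optPosition, ih (Nat.le_of_succ_le hi)]
    classical exact if_congr this rfl rfl

lemma optPosition_mono {d n : ℕ} (u : ℕ → ℝ) : Monotone (optPosition d n u) := by
  refine monotone_nat_of_le_succ fun i => ?_
  simp only [optPosition]
  split_ifs with h
  · exact h.1.le
  · exact le_rfl

lemma isModal_optSelected {d n : ℕ} {u : ℕ → ℝ} (hu : ∀ i, u i ∈ Set.Icc (0 : ℝ) 1)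
    {x : Fin n → ℝ} (hux : ∀ i j : Fin n, x i ≤ x j → u i ≤ u j) :
    IsModal d x (optSelected d n u) := by
  set p : Fin n → ℝ := fun i => nextPos (optPosition d n u i) (u i) with hp
  have hacc : ∀ i ∈ optSelected d n u, Accepts d (n - 1 - i) (optPosition d n u i) (u i) := by
    intro i hi; simpa [optSelected] using hi
  have hlt : ∀ i ∈ optSelected d n u, ∀ j ∈ optSelected d n u, i < j → p i < p j := by
    intro i hi j hj hij
    have h1 : p i = optPosition d n u (i + 1) := by
      simp only [optPosition]; rw [if_pos (hacc i hi)]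
    rw [h1]
    exact (optPosition_mono u (Nat.succ_le_of_lt hij)).trans_lt (hacc j hj).1
  have hblock : ∀ i : Fin n, p i = pathPos (nextBlock (optPosition d n u i) (u i)) (u i) :=
    fun i => rfl
  refine ⟨fun i => nextBlock (optPosition d n u i) (u i), ?_, ?_, ?_⟩
  · intro i hi j hj hij
    rcases hij.eq_or_lt with rfl | hij
    · exact le_rfl
    have h1 := hlt i hi j hj hij
    rw [hblock, hblock] at h1
    have h2 := (le_pathPos (hu i)).trans_lt (h1.trans_le (pathPos_le (hu j)))
    exact Nat.lt_succ_iff.1 (by exact_mod_cast h2)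
  · intro i hi
    have h2 := (le_pathPos (hu i)).trans_lt (hacc i hi).2.1
    exact Nat.lt_succ_iff.1 (by exact_mod_cast h2)
  · intro i hi j hj hij heq
    have h1 := hlt i hi j hj hij
    beta_reduce at heq ⊢
    rw [hblock, hblock, ← heq] at h1
    unfold pathPos at h1
    constructor <;> intro hpar
    · rw [if_pos hpar, if_pos hpar] at h1
      by_contra! hcon
      linarith [hux _ _ hcon.le]
    · rw [if_neg (Nat.not_even_iff_odd.2 hpar), if_neg (Nat.not_even_iff_odd.2 hpar)] at h1
      by_contra! hcon
      linarith [hux _ _ hcon.le]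

/-! ### Measurability -/

section Measurability

variable {Ω : Type*} {X : ℕ → Ω → ℝ} {F : ℝ → ℝ} {d n : ℕ}

/-- The σ-field generated by the observations before time `i`. -/
abbrev past (X : ℕ → Ω → ℝ) (i : ℕ) : MeasurableSpace Ω :=
  ⨆ j ∈ Set.Iio i, MeasurableSpace.comap (X j) inferInstance

lemma past_succ (X : ℕ → Ω → ℝ) (i : ℕ) : past X (i + 1) = history X i := by
  simp [past, history]

lemma past_mono (X : ℕ → Ω → ℝ) (i : ℕ) : past X i ≤ past X (i + 1) :=
  biSup_mono fun _ hj => Nat.lt_succ_of_lt hj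

lemma measurable_past (X : ℕ → Ω → ℝ) (i : ℕ) : Measurable[past X (i + 1)] (X i) :=
  measurable_iff_comap_le.2
    (le_biSup (fun j => MeasurableSpace.comap (X j) inferInstance) (Nat.lt_succ_self i))

lemma measurableSet_accepts (d k : ℕ) : MeasurableSet {z : ℝ × ℝ | Accepts d k z.1 z.2} := by
  have hv := measurable_value (d := d) k
  exact (measurableSet_lt measurable_fst measurable_nextPos).inter
    ((measurableSet_lt measurable_nextPos measurable_const).inter
      (measurableSet_lt (hv.comp measurable_fst) ((hv.comp measurable_nextPos).const_add 1)))

open Classical in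
lemma measurable_ite_nextPos {m : MeasurableSpace Ω} {y u : Ω → ℝ} {a : Ω → Prop}
    (ha : MeasurableSet {ω | a ω}) (hy : Measurable y) (hu : Measurable u) :
    Measurable fun ω => if a ω then nextPos (y ω) (u ω) else y ω :=
  Measurable.ite ha (measurable_nextPos.comp (hy.prodMk hu)) hy

lemma measurable_optPosition (hF : Measurable F) (i : ℕ) :
    Measurable[past X i] fun ω => optPosition d n (fun j => F (X j ω)) i := by
  induction i with
  | zero => exact measurable_const
  | succ i ih =>
    have hu : Measurable[past X (i + 1)] fun ω => F (X i ω) := hF.comp (measurable_past X i)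
    have hy := ih.mono (past_mono X i) le_rfl
    have := hy.prodMk hu
    exact measurable_ite_nextPos (this (measurableSet_accepts d (n - 1 - i))) hy hu

lemma measurableSet_chosen (q : Policy X d n) (i : ℕ) :
    MeasurableSet[past X (i + 1)] {ω | i ∈ chosen (q.selected ω)} := by
  by_cases hi : i < n
  · have := q.nonanticipating ⟨i, hi⟩
    rw [past_succ]
    simpa [chosen, hi] using this
  · simp [chosen, hi]

lemma measurable_position (hF : Measurable F) (q : Policy X d n) (i : ℕ) :
    Measurable[past X i] fun ω => position (fun j => F (X j ω)) (chosen (q.selected ω)) i := by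
  induction i with
  | zero => exact measurable_const
  | succ i ih =>
    have hu : Measurable[past X (i + 1)] fun ω => F (X i ω) := hF.comp (measurable_past X i)
    have hy := ih.mono (past_mono X i) le_rfl
    exact measurable_ite_nextPos (measurableSet_chosen q i) hy hu

/-- The policy that follows the optimal decision rule for the scores `F (X i)`. -/
noncomputable def optPolicy (X : ℕ → Ω → ℝ) (hF : Monotone F)
    (hF01 : ∀ x, F x ∈ Set.Icc (0 : ℝ) 1) (d n : ℕ) : Policy X d n where
  selected ω := optSelected d n fun j => F (X j ω)
  nonanticipating i := by
    have hu : Measurable[past X (i + 1)] fun ω => F (X i ω) :=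
      hF.measurable.comp (measurable_past X i)
    have hy := (measurable_optPosition (X := X) (d := d) (n := n) hF.measurable i).mono
      (past_mono X i) le_rfl
    have := (hy.prodMk hu) (measurableSet_accepts d (n - 1 - i))
    rw [← past_succ]
    simpa [optSelected] using this
  modal ω := isModal_optSelected (fun _ => hF01 _) fun _ _ h => hF h

end Measurability

/-! ### Independence of the position and the next score -/

section Independence

variable {Ω : Type*} [MeasurableSpace Ω] {μ : Measure Ω}
  {X : ℕ → Ω → ℝ} {F : ℝ → ℝ} {d n : ℕ}

/-- The observations `X i` are independent and the monotone function `F` turns each of them into a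
score that is uniformly distributed on the unit interval. -/
structure UniformScores {Ω : Type*} [MeasurableSpace Ω] (μ : Measure Ω) (X : ℕ → Ω → ℝ)
    (F : ℝ → ℝ) : Prop where
  measurable : ∀ i, Measurable (X i)
  indep : iIndepFun X μ
  mono : Monotone F
  mem_Icc : ∀ x, F x ∈ Set.Icc (0 : ℝ) 1
  law : ∀ i, μ.map (fun ω => F (X i ω)) = unif

lemma past_le (hX : ∀ i, Measurable (X i)) (i : ℕ) : past X i ≤ ‹MeasurableSpace Ω› :=
  iSup₂_le fun j _ => (hX j).comap_le

lemma map_prodMk_eq [IsProbabilityMeasure μ] (h : UniformScores μ X F) {i : ℕ} {Y : Ω → ℝ}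
    (hY : Measurable[past X i] Y) :
    μ.map (fun ω => (Y ω, F (X i ω))) = (μ.map Y).prod unif := by
  have hindep : Indep (past X i)
      (⨆ j ∈ ({i} : Set ℕ), MeasurableSpace.comap (X j) inferInstance) μ :=
    indep_iSup_of_disjoint (fun j => (h.measurable j).comap_le) h.indep (by simp)
  have hYU : IndepFun Y (fun ω => F (X i ω)) μ := by
    refine indep_of_indep_of_le_left (indep_of_indep_of_le_right hindep ?_)
      (measurable_iff_comap_le.1 hY)
    have : MeasurableSpace.comap (fun ω => F (X i ω)) inferInstance ≤
        MeasurableSpace.comap (X i) inferInstance :=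
      measurable_iff_comap_le.1 (h.mono.measurable.comp (comap_measurable (X i)))
    simpa using this
  have hYm : Measurable Y := hY.mono (past_le h.measurable i) le_rfl
  have hU : Measurable fun ω => F (X i ω) := h.mono.measurable.comp (h.measurable i)
  rw [(indepFun_iff_map_prod_eq_prod_map_map hYm.aemeasurable hU.aemeasurable).1 hYU,
    h.law]

lemma ae_of_forall_ae_unif [IsProbabilityMeasure μ] (h : UniformScores μ X F) {i : ℕ} {Y : Ω → ℝ}
    (hY : Measurable[past X i] Y) (hY0 : ∀ ω, 0 ≤ Y ω) {S : Set (ℝ × ℝ)} (hS : MeasurableSet S)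
    (hSu : ∀ y, 0 ≤ y → ∀ᵐ u ∂unif, (y, u) ∈ S) : ∀ᵐ ω ∂μ, (Y ω, F (X i ω)) ∈ S := by
  have hYm : Measurable Y := hY.mono (past_le h.measurable i) le_rfl
  have hU : Measurable fun ω => F (X i ω) := h.mono.measurable.comp (h.measurable i)
  rw [← ae_map_iff (p := fun z => z ∈ S) (hYm.prodMk hU).aemeasurable hS,
    map_prodMk_eq h hY, Measure.ae_prod_mem_iff_ae_ae_mem hS]
  have : ∀ᵐ y ∂μ.map Y, 0 ≤ y :=
    (ae_map_iff hYm.aemeasurable measurableSet_Ici).2 (Eventually.of_forall hY0)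
  exact this.mono hSu

/-- The position before time `i` is independent of the `i`-th score, so that the better decision is
worth the value of the position on average. -/
lemma integral_bellman_eq [IsProbabilityMeasure μ] (h : UniformScores μ X F) {i : ℕ} {Y : Ω → ℝ}
    (hY : Measurable[past X i] Y) (k : ℕ) :
    ∫ ω, bellman d (value d k) (Y ω) (F (X i ω)) ∂μ = ∫ ω, value d (k + 1) (Y ω) ∂μ := by
  have hYm : Measurable Y := hY.mono (past_le h.measurable i) le_rfl
  have hm := measurable_bellman (d := d) (measurable_value (d := d) k)
  have : IsProbabilityMeasure (μ.map Y) := Measure.isProbabilityMeasure_map hYm.aemeasurable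
  have hint : Integrable (fun z : ℝ × ℝ => bellman d (value d k) z.1 z.2)
      ((μ.map Y).prod unif) := by
    refine Integrable.of_bound (C := (k : ℝ) + 1) hm.aestronglyMeasurable
      (Eventually.of_forall fun z => ?_)
    have := bellman_mem (d := d) (value_mem (d := d) k) z.1 z.2
    rw [Real.norm_of_nonneg this.1]; exact this.2
  have h1 := integral_map (μ := μ) (φ := fun ω => (Y ω, F (X i ω)))
    (hYm.prodMk (h.mono.measurable.comp (h.measurable i))).aemeasurable
    (f := fun z : ℝ × ℝ => bellman d (value d k) z.1 z.2) hm.aestronglyMeasurable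
  rw [← h1, map_prodMk_eq h hY, integral_prod _ hint]
  exact integral_map hYm.aemeasurable (measurable_value (d := d) (k + 1)).aestronglyMeasurable

end Independence

/-! ### Regret -/

section Regret

variable {Ω : Type*} [MeasurableSpace Ω] {μ : Measure Ω}
  {X : ℕ → Ω → ℝ} {F : ℝ → ℝ} {d n : ℕ}

open Classical in
/-- What is lost by accepting (if `a` holds) or rejecting (if it does not) the score `u` at the
position `y`, compared with the better of the two decisions. -/
noncomputable def regret (d k : ℕ) (y u : ℝ) (a : Prop) : ℝ :=
  bellman d (value d k) y u -
    ((if a then 1 else 0) + value d k (if a then nextPos y u else y))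

lemma regret_nonneg {k : ℕ} {y u : ℝ} {a : Prop} (h : a → nextPos y u ≤ d + 1) :
    0 ≤ regret d k y u a := by
  unfold regret
  split_ifs with ha
  · exact sub_nonneg.2 (one_add_le_bellman _ (h ha))
  · simpa using le_bellman _ _ _

lemma regret_eq_zero_iff {k : ℕ} {y u : ℝ} (h1 : y < nextPos y u) (h2 : nextPos y u ≠ d + 1)
    (h3 : nextPos y u ≤ d + 1 → 1 + value d k (nextPos y u) ≠ value d k y) {a : Prop}
    (ha : a → nextPos y u ≤ d + 1) : regret d k y u a = 0 ↔ (a ↔ Accepts d k y u) := by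
  unfold regret bellman Accepts
  by_cases hle : nextPos y u ≤ d + 1
  · have hlt := lt_of_le_of_ne hle h2
    have h3' := h3 hle
    rw [if_pos hle]
    simp only [h1, hlt, true_and]
    by_cases h : a
    · simp only [h, if_true, true_iff]
      constructor
      · intro h0
        refine lt_of_le_of_ne ?_ h3'.symm
        linarith [le_max_left (value d k y) (1 + value d k (nextPos y u))]
      · intro h0
        rw [max_eq_right h0.le, sub_self]
    · simp only [h, if_false, false_iff, zero_add, not_lt]
      constructor
      · intro h0
        linarith [le_max_right (value d k y) (1 + value d k (nextPos y u))]
      · intro h0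
        rw [max_eq_left h0, sub_self]
  · have hna : ¬ a := fun h => hle (ha h)
    have : ¬ nextPos y u < d + 1 := fun h => hle h.le
    simp [hle, hna, this]

/-- Almost surely, `regret_eq_zero_iff` applies to the `i`-th score. -/
lemma ae_of_ne_nextPos [IsProbabilityMeasure μ] (h : UniformScores μ X F) {i : ℕ} {Y : Ω → ℝ}
    (hY : Measurable[past X i] Y) (hY0 : ∀ ω, 0 ≤ Y ω) (d k : ℕ) :
    ∀ᵐ ω ∂μ, Y ω < nextPos (Y ω) (F (X i ω)) ∧ nextPos (Y ω) (F (X i ω)) ≠ d + 1 ∧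
      (nextPos (Y ω) (F (X i ω)) ≤ d + 1 →
        1 + value d k (nextPos (Y ω) (F (X i ω))) ≠ value d k (Y ω)) := by
  have hv := measurable_value (d := d) k
  refine ae_of_forall_ae_unif h hY hY0 (S := {z : ℝ × ℝ | z.1 < nextPos z.1 z.2 ∧
    nextPos z.1 z.2 ≠ d + 1 ∧
      (nextPos z.1 z.2 ≤ d + 1 → 1 + value d k (nextPos z.1 z.2) ≠ value d k z.1)})
    ?_ fun y hy => ?_
  · refine (measurableSet_lt measurable_fst measurable_nextPos).inter
      ((measurableSet_eq_fun measurable_nextPos measurable_const).compl.inter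
        (MeasurableSet.imp (measurableSet_le measurable_nextPos measurable_const)
          (measurableSet_eq_fun ((hv.comp measurable_nextPos).const_add 1)
            (hv.comp measurable_fst)).compl))
  · filter_upwards [ae_unif_mem, ae_unif_nextPos_ne y y, ae_unif_nextPos_ne y (d + 1),
      ae_unif_no_tie (d := d) k hy] with u hu h1 h2 h3
    exact ⟨lt_of_le_of_ne (le_nextPos hu) h1.symm, h2, h3⟩

end Regret

/-- A selection that follows the optimal rule at its own positions is the optimal one. -/
lemma eq_optSelected_iff {d n : ℕ} (u : ℕ → ℝ) (s : Finset (Fin n)) :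
    (∀ i < n, (i ∈ chosen s ↔ Accepts d (n - 1 - i) (position u (chosen s) i) (u i))) ↔
      s = optSelected d n u := by
  constructor
  · intro h
    have hpos : ∀ i ≤ n, position u (chosen s) i = optPosition d n u i := by
      intro i hi
      induction i with
      | zero => rfl
      | succ i ih =>
        have h1 := h i (by omega)
        have h2 := ih (by omega)
        rw [h2] at h1
        simp only [position, optPosition, h2]
        classical exact if_congr h1 rfl rfl
    ext i
    have h1 := h i i.2
    rw [hpos i i.2.le] at h1
    simpa [chosen, optSelected] using h1
  · rintro rfl i hi
    rw [position_optSelected u hi.le]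
    simp [chosen, optSelected, hi]

open Classical in
lemma card_eq_sum_chosen {n : ℕ} (s : Finset (Fin n)) :
    (s.card : ℝ) = ∑ i ∈ Finset.range n, if i ∈ chosen s then (1 : ℝ) else 0 := by
  rw [Finset.sum_range (fun i => if i ∈ chosen s then (1 : ℝ) else 0)]
  simp [chosen]

/-- The regret of the decision of the policy `q` at time `i`. -/
noncomputable def stepRegret {Ω : Type*} {X : ℕ → Ω → ℝ} {d n : ℕ} (F : ℝ → ℝ)
    (q : Policy X d n) (i : ℕ) (ω : Ω) : ℝ :=
  regret d (n - 1 - i) (position (fun j => F (X j ω)) (chosen (q.selected ω)) i) (F (X i ω))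
    (i ∈ chosen (q.selected ω))

open Classical in
lemma stepRegret_eq {Ω : Type*} {X : ℕ → Ω → ℝ} {F : ℝ → ℝ} {d n : ℕ} (q : Policy X d n)
    (i : ℕ) (ω : Ω) : stepRegret F q i ω =
    bellman d (value d (n - 1 - i))
      (position (fun j => F (X j ω)) (chosen (q.selected ω)) i) (F (X i ω)) -
    ((if i ∈ chosen (q.selected ω) then 1 else 0) +
      value d (n - 1 - i) (position (fun j => F (X j ω)) (chosen (q.selected ω)) (i + 1))) := rfl

section Optimality

variable {Ω : Type*} [MeasurableSpace Ω] {μ : Measure Ω}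
  {X : ℕ → Ω → ℝ} {F : ℝ → ℝ} {d n : ℕ}

lemma nextPos_le_of_chosen (h : UniformScores μ X F) (q : Policy X d n) (i : ℕ) (ω : Ω)
    (hi : i ∈ chosen (q.selected ω)) :
    nextPos (position (fun j => F (X j ω)) (chosen (q.selected ω)) i) (F (X i ω)) ≤ d + 1 := by
  have := position_le_of_isModal (q.modal ω) (u := fun j => F (X j ω)) (fun _ => h.mem_Icc _)
    (fun _ _ hij => h.mono hij) (i + 1)
  simpa only [position, if_pos hi] using this

lemma stepRegret_nonneg (h : UniformScores μ X F) (q : Policy X d n) (i : ℕ) (ω : Ω) :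
    0 ≤ stepRegret F q i ω :=
  regret_nonneg (nextPos_le_of_chosen h q i ω)

lemma integrable_value_comp [IsProbabilityMeasure μ] {Y : Ω → ℝ} (hY : Measurable Y) (k : ℕ) :
    Integrable (fun ω => value d k (Y ω)) μ := by
  refine Integrable.of_bound (C := (k : ℝ)) ((measurable_value k).comp hY).aestronglyMeasurable
    (Eventually.of_forall fun ω => ?_)
  have := value_mem (d := d) k (Y ω)
  rw [Real.norm_of_nonneg this.1]; exact this.2

lemma integrable_bellman_comp [IsProbabilityMeasure μ] {Y U : Ω → ℝ} (hY : Measurable Y)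
    (hU : Measurable U) (k : ℕ) :
    Integrable (fun ω => bellman d (value d k) (Y ω) (U ω)) μ := by
  refine Integrable.of_bound (C := (k : ℝ) + 1)
    ((measurable_bellman (measurable_value k)).comp (hY.prodMk hU)).aestronglyMeasurable
    (Eventually.of_forall fun ω => ?_)
  have := bellman_mem (d := d) (value_mem (d := d) k) (Y ω) (U ω)
  rw [Real.norm_of_nonneg this.1]; exact this.2

open Classical in
lemma integrable_chosen [IsProbabilityMeasure μ] (h : UniformScores μ X F)
    (q : Policy X d n) (i : ℕ) :
    Integrable (fun ω => if i ∈ chosen (q.selected ω) then (1 : ℝ) else 0) μ := by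
  refine Integrable.of_bound (C := 1) (Measurable.ite
    (past_le h.measurable (i + 1) _ (measurableSet_chosen q i)) measurable_const
    measurable_const).aestronglyMeasurable (Eventually.of_forall fun ω => ?_)
  split_ifs <;> simp

lemma integrable_stepRegret [IsProbabilityMeasure μ] (h : UniformScores μ X F)
    (q : Policy X d n) (i : ℕ) :
    Integrable (stepRegret F q i) μ := by
  classical
  have hY := fun i => (measurable_position h.mono.measurable q i).mono
    (past_le h.measurable i) le_rfl
  have hU : Measurable fun ω => F (X i ω) := h.mono.measurable.comp (h.measurable i)
  simp only [funext (stepRegret_eq (F := F) q i)]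
  exact (integrable_bellman_comp (hY i) hU _).sub
    ((integrable_chosen h q i).add (integrable_value_comp (hY (i + 1)) _))

/-- The expected length of a policy falls short of the value by the sum of its expected regrets:
the number of selections so far plus the value of the current position is a supermartingale, and
its mean decreases by the expected regret at each step. -/
theorem expectedLength_eq [IsProbabilityMeasure μ] (h : UniformScores μ X F) (q : Policy X d n) :
    expectedLength μ q = value d n 0 - ∑ i ∈ Finset.range n, ∫ ω, stepRegret F q i ω ∂μ := by
  classical
  have hY := fun i => (measurable_position h.mono.measurable q i).mono
    (past_le h.measurable i) le_rfl
  set v : ℕ → ℝ := fun i =>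
    ∫ ω, value d (n - i) (position (fun j => F (X j ω)) (chosen (q.selected ω)) i) ∂μ with hv
  have hstep : ∀ i ∈ Finset.range n, ∫ ω, stepRegret F q i ω ∂μ =
      (v i - v (i + 1)) - ∫ ω, (if i ∈ chosen (q.selected ω) then (1 : ℝ) else 0) ∂μ := by
    intro i hi
    have hi := Finset.mem_range.1 hi
    have hU : Measurable fun ω => F (X i ω) := h.mono.measurable.comp (h.measurable i)
    simp only [stepRegret_eq]
    have hadd := (integrable_chosen h q i).add
      (integrable_value_comp (d := d) (hY (i + 1)) (n - 1 - i))
    simp only [Pi.add_def] at hadd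
    rw [integral_sub (integrable_bellman_comp (hY i) hU _) hadd,
      integral_add (integrable_chosen h q i) (integrable_value_comp (hY (i + 1)) _),
      integral_bellman_eq h (measurable_position h.mono.measurable q i)]
    simp only [hv]
    rw [show n - 1 - i + 1 = n - i by omega, show n - 1 - i = n - (i + 1) by omega]
    ring
  have hE : expectedLength μ q = ∑ i ∈ Finset.range n,
      ∫ ω, (if i ∈ chosen (q.selected ω) then (1 : ℝ) else 0) ∂μ := by
    rw [expectedLength, ← integral_finsetSum _ fun i _ => integrable_chosen h q i]
    simp only [card_eq_sum_chosen]
  rw [hE, Finset.sum_congr rfl hstep, Finset.sum_sub_distrib, Finset.sum_range_sub']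
  have h0 : v 0 = value d n 0 := by simp [hv, position]
  have hn : v n = 0 := by simp [hv, value]
  rw [h0, hn]
  ring

theorem expectedLength_le [IsProbabilityMeasure μ] (h : UniformScores μ X F) (q : Policy X d n) :
    expectedLength μ q ≤ value d n 0 := by
  rw [expectedLength_eq h q]
  have : 0 ≤ ∑ i ∈ Finset.range n, ∫ ω, stepRegret F q i ω ∂μ :=
    Finset.sum_nonneg fun i _ => integral_nonneg fun ω => stepRegret_nonneg h q i ω
  linarith

/-- A policy attains the value if and only if it almost surely follows the optimal decision rule. -/
theorem expectedLength_eq_value_iff [IsProbabilityMeasure μ] (h : UniformScores μ X F)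
    (q : Policy X d n) :
    expectedLength μ q = value d n 0 ↔
      ∀ᵐ ω ∂μ, q.selected ω = optSelected d n fun j => F (X j ω) := by
  have hiff : ∀ i, ∀ᵐ ω ∂μ, (stepRegret F q i ω = 0 ↔ (i ∈ chosen (q.selected ω) ↔
      Accepts d (n - 1 - i) (position (fun j => F (X j ω)) (chosen (q.selected ω)) i)
        (F (X i ω)))) := by
    intro i
    filter_upwards [ae_of_ne_nextPos h (measurable_position h.mono.measurable q i)
      (fun ω => position_nonneg (fun _ => h.mem_Icc _) _ _) d (n - 1 - i)] with ω hω
    exact regret_eq_zero_iff hω.1 hω.2.1 hω.2.2 (nextPos_le_of_chosen h q i ω)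
  have hall : (∀ᵐ ω ∂μ, q.selected ω = optSelected d n fun j => F (X j ω)) ↔
      ∀ i < n, stepRegret F q i =ᵐ[μ] 0 := by
    have : ∀ᵐ ω ∂μ, ((q.selected ω = optSelected d n fun j => F (X j ω)) ↔
        ∀ i < n, stepRegret F q i ω = 0) := by
      filter_upwards [ae_all_iff.2 hiff] with ω hω
      rw [← eq_optSelected_iff (fun j => F (X j ω))]
      exact forall₂_congr fun i _ => (hω i).symm
    rw [eventually_congr this]
    simp only [ae_all_iff]
    rfl
  have hint : ∀ i, (∫ ω, stepRegret F q i ω ∂μ = 0 ↔ stepRegret F q i =ᵐ[μ] 0) := fun i =>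
    integral_eq_zero_iff_of_nonneg (stepRegret_nonneg h q i) (integrable_stepRegret h q i)
  rw [hall, expectedLength_eq h q, sub_eq_self, Finset.sum_eq_zero_iff_of_nonneg
    fun i _ => integral_nonneg fun ω => stepRegret_nonneg h q i ω]
  simp only [Finset.mem_range, hint]

end Optimality

/-! ### The asymptotic statement -/

lemma rpow_quarter {x : ℝ} (hx : 0 ≤ x) : x ^ (1 / 4 : ℝ) = √√x := by
  rw [Real.sqrt_eq_rpow, Real.sqrt_eq_rpow, ← Real.rpow_mul hx]; norm_num

lemma rpow_three_quarters {x : ℝ} (hx : 0 < x) : x ^ (3 / 4 : ℝ) = √x * √√x := by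
  rw [← rpow_quarter hx.le, Real.sqrt_eq_rpow, ← Real.rpow_add hx]; norm_num

lemma isEquivalent_value (d : ℕ) : Asymptotics.IsEquivalent atTop
    (fun n : ℕ => value d n 0) (fun n : ℕ => √(2 * ((d : ℝ) + 1) * (n : ℝ))) := by
  set K := √(2 * ((d : ℝ) + 1)) * √√(2 * (d + 1)) * √(Real.pi / 3) with hK
  have hK0 : 0 ≤ K := by positivity
  have hc : √(2 * ((d : ℝ) + 1)) ≠ 0 := by positivity
  have hlim : Tendsto (fun n : ℕ => √√(n : ℝ)) atTop atTop :=
    Real.tendsto_sqrt_atTop.comp (Real.tendsto_sqrt_atTop.comp tendsto_natCast_atTop_atTop)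
  have e : (fun n : ℕ => √(2 * ((d : ℝ) + 1) * (n : ℝ))) =
      fun n : ℕ => √(2 * ((d : ℝ) + 1)) * √(n : ℝ) := by
    funext n; rw [Real.sqrt_mul (by positivity)]
  rw [e]
  have h1 : (fun n : ℕ => value d n 0 - √(2 * ((d : ℝ) + 1)) * √(n : ℝ)) =O[atTop]
      fun n : ℕ => √√(n : ℝ) := by
    refine Asymptotics.IsBigO.of_bound (K + 1) ?_
    filter_upwards [eventually_ge_atTop 1] with n hn
    have hn1 : 1 ≤ √√(n : ℝ) := by
      rw [Real.one_le_sqrt, Real.one_le_sqrt]; exact_mod_cast hn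
    have hlow := lt_value (d := d) hn
    have hupp := value_lt_sqrt (d := d) hn
    rw [Real.norm_eq_abs, Real.norm_of_nonneg (Real.sqrt_nonneg _), abs_le]
    constructor <;> nlinarith
  have h2 : (fun n : ℕ => √√(n : ℝ)) =o[atTop] fun n : ℕ => √(n : ℝ) := by
    have h3 : (fun _ : ℕ => (1 : ℝ)) =o[atTop] fun n : ℕ => √√(n : ℝ) :=
      (Asymptotics.isLittleO_const_left.2 (Or.inr (tendsto_norm_atTop_atTop.comp hlim)))
    have := h3.mul_isBigO (Asymptotics.isBigO_refl (fun n : ℕ => √√(n : ℝ)) atTop)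
    simpa [Real.mul_self_sqrt] using this
  exact h1.trans_isLittleO (h2.const_mul_right hc)

end ModalSelection

theorem mainTheorem6 :
    ∃ C : ℝ, ∀ (Ω : Type*) [MeasurableSpace Ω] (μ : Measure Ω) [IsProbabilityMeasure μ]
      (X : ℕ → Ω → ℝ),
      (∀ i, Measurable (X i)) →
      iIndepFun X μ →
      (∀ i, IdentDistrib (X i) (X 0) μ μ) →
      Continuous (cdf (μ.map (X 0))) →
      ∃ p : ∀ d n : ℕ, ModalSelection.Policy X d n,
        (∀ d n : ℕ, 1 ≤ n →
          (ModalSelection.IsOptimal μ (p d n) ∧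
            ∀ q : ModalSelection.Policy X d n, ModalSelection.IsOptimal μ q →
              ∀ᵐ ω ∂μ, q.selected ω = (p d n).selected ω) ∧
          (2 * ((d : ℝ) + 1)) ^ (1 / 2 : ℝ) * (n : ℝ) ^ (1 / 2 : ℝ)
              - (2 * ((d : ℝ) + 1)) ^ (3 / 4 : ℝ) * (Real.pi / 3) ^ (1 / 2 : ℝ)
                * (n : ℝ) ^ (1 / 4 : ℝ)
              - C
            < ModalSelection.expectedLength μ (p d n) ∧
          ModalSelection.expectedLength μ (p d n)
            < (2 * ((d : ℝ) + 1)) ^ (1 / 2 : ℝ) * (n : ℝ) ^ (1 / 2 : ℝ)) ∧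
        ∀ d : ℕ,
          Asymptotics.IsEquivalent atTop
            (fun n : ℕ => ModalSelection.expectedLength μ (p d n))
            (fun n : ℕ => Real.sqrt (2 * ((d : ℝ) + 1) * (n : ℝ))) := by
  refine ⟨1, fun Ω _ μ _ X hX hind hid hcont => ?_⟩
  have : IsProbabilityMeasure (μ.map (X 0)) := Measure.isProbabilityMeasure_map (hX 0).aemeasurable
  have h : ModalSelection.UniformScores μ X (cdf (μ.map (X 0))) :=
    { measurable := hX
      indep := hind
      mono := monotone_cdf _
      mem_Icc := fun x => ⟨cdf_nonneg _ x, cdf_le_one _ x⟩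
      law := fun i => by
        rw [← ModalSelection.map_cdf_eq_unif _ hcont, ← (hid i).map_eq,
          Measure.map_map (by rw [(hid i).map_eq]; exact (monotone_cdf _).measurable) (hX i),
          (hid i).map_eq]
        rfl }
  have hval : ∀ d n, ModalSelection.expectedLength μ
      (ModalSelection.optPolicy X h.mono h.mem_Icc d n) = ModalSelection.value d n 0 := fun d n =>
    (ModalSelection.expectedLength_eq_value_iff h _).2 (Eventually.of_forall fun _ => rfl)
  have hopt : ∀ d n, ModalSelection.IsOptimal μ
      (ModalSelection.optPolicy X h.mono h.mem_Icc d n) := fun d n =>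
    IsGreatest.isLUB ⟨⟨_, rfl⟩, by
      rintro _ ⟨q, rfl⟩
      rw [hval]
      exact ModalSelection.expectedLength_le h q⟩
  refine ⟨fun d n => ModalSelection.optPolicy X h.mono h.mem_Icc d n, fun d n hn =>
    ⟨⟨hopt d n, fun q hq => ?_⟩, ?_, ?_⟩, fun d => ?_⟩
  · refine (ModalSelection.expectedLength_eq_value_iff h q).1 ?_
    rw [← hval]
    exact hq.unique (hopt d n)
  · rw [hval, ← Real.sqrt_eq_rpow, ← Real.sqrt_eq_rpow, ← Real.sqrt_eq_rpow,
      ModalSelection.rpow_quarter (by positivity),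
      ModalSelection.rpow_three_quarters (by positivity)]
    exact ModalSelection.lt_value hn
  · rw [hval, ← Real.sqrt_eq_rpow, ← Real.sqrt_eq_rpow]
    exact ModalSelection.value_lt_sqrt hn
  · simp only [hval]
    exact ModalSelection.isEquivalent_value d
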